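/- For $f,g\in C[0,1]$ let $\mathsf{cr}(f,g)=\{x\in[0,1]: f(x)-g(x)\in\mathbb Z\}$, that is, the set of points where $f$ and $g$ have the same fractional part. A countable set $V\subseteq C[0,1]$ is called \emph{infinite-crossing-dense} (IC-dense) if 1. $V$ is dense in $C[0,1]$ with respect to the supremum norm; 2. the sets $\mathsf{cr}(f,g)$ and $\mathsf{cr}(h,k)$ are disjoint whenever $\{f,g\}\neq\{h,k\}$ are two different pairs of distinct elements of $V$; 3. for all distinct $f,g\in V$, $\mathsf{cr}(f,g)$ contains neither $0$ nor $1$; 4. for all distinct $f,g\in V$ and every $x\in\mathsf{cr}(f,g)$ there is a sequence $(x_n)_{n\ge 0}$ in $[0,1]$ converging monotonically to $x$ such that, for each $n$, $f(x_{2n})-g(x_{2n})<f(x)-g(x)$ and $f(x_{2n+1})-g(x_{2n+1})>f(x)-g(x)$. For a set $V\subseteq C[0,1]$ and $p\in(0,1)$, the local area random graph $\mathrm{LARG}(V,p)$ is the random simple graph with vertex set $V$ in which every pair of distinct $u,v\in V$ with $\|u-v\|_\infty<1$ is joined by an edge independently with probability $p$, and no other pairs are joined. \textbf{Theorem.} There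 is a single graph $GR(\mathrm{ICD})$ on a countably infinite vertex set such that, for every IC-dense set $V\subseteq C[0,1]$ and every $p\in(0,1)$, $\mathrm{LARG}(V,p)$ is almost surely isomorphic to $GR(\mathrm{ICD})$. -/

import Mathlib

open MeasureTheory ProbabilityTheory Filter Topology

/-- The crossing set `cr(f, g)` of two functions in `C[0,1]`: the points `x` at which the
fractional parts of `f x` and `g x` agree. -/
def crossingSet (f g : C(unitInterval, ℝ)) : Set unitInterval :=
  {x | Int.fract (f x) = Int.fract (g x)}

/-- Infinite-crossing-dense (IC-dense) subsets of `C[0,1]` (with the supremum norm). -/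
structure IsICDense (V : Set C(unitInterval, ℝ)) : Prop where
  countable : V.Countable
  dense : Dense V
  /-- Crossing sets of different (unordered) pairs of distinct functions are disjoint. -/
  disjoint_crossingSet : ∀ f ∈ V, ∀ g ∈ V, ∀ h ∈ V, ∀ k ∈ V, f ≠ g → h ≠ k →
    s(f, g) ≠ s(h, k) → Disjoint (crossingSet f g) (crossingSet h k)
  zero_notMem_crossingSet : ∀ f ∈ V, ∀ g ∈ V, f ≠ g → (0 : unitInterval) ∉ crossingSet f g
  one_notMem_crossingSet : ∀ f ∈ V, ∀ g ∈ V, f ≠ g → (1 : unitInterval) ∉ crossingSet f g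
  /-- At every crossing point `x` the functions cross infinitely often: some sequence converges
  monotonically to `x`, and along it `f - g` is alternately below and above the integer
  `f x - g x`, i.e. the circular order of `f` and `g` modulo `1` near `x` alternates. -/
  infinite_crossing : ∀ f ∈ V, ∀ g ∈ V, f ≠ g → ∀ x ∈ crossingSet f g,
    ∃ u : ℕ → unitInterval, (Monotone u ∨ Antitone u) ∧ Tendsto u atTop (𝓝 x) ∧
      (∀ n, f (u (2 * n)) - g (u (2 * n)) < f x - g x) ∧
      (∀ n, f x - g x < f (u (2 * n + 1)) - g (u (2 * n + 1)))

/-- The graph on a subset `V` of a normed space in which two distinct points are adjacent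
exactly when they are at distance less than `1`. -/
def proximityGraph {X : Type*} [NormedAddCommGroup X] (V : Set X) : SimpleGraph V where
  Adj u v := u ≠ v ∧ ‖(u : X) - (v : X)‖ < 1
  symm := ⟨fun u v h => ⟨h.1.symm, by rw [norm_sub_rev]; exact h.2⟩⟩
  loopless := ⟨fun _ h => h.1 rfl⟩

/-- The law, on simple graphs with vertex set `V`, of the local area random graph `LARG(V, p)`:
each pair of distinct points of `V` at distance less than `1` is joined by an edge independently
with probability `p`, and no other pair is joined. -/
noncomputable def LARG {X : Type*} [NormedAddCommGroup X] (V : Set X) (p : unitInterval) :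
    Measure (SimpleGraph V) :=
  (setBernoulli (proximityGraph V).edgeSet p).map SimpleGraph.fromEdgeSet

instance {X : Type*} [NormedAddCommGroup X] (V : Set X) (p : unitInterval) :
    IsProbabilityMeasure (LARG V p) :=
  Measure.isProbabilityMeasure_map SimpleGraph.measurable_fromEdgeSet.aemeasurable

/-! Randomness and geometry separate. By Borel–Cantelli, almost every LARG on a countable dense set
is geometrically e.c.: each nonempty open set contains a new vertex with any prescribed adjacencies
to finitely many others, provided all vertices in the set are within distance 1 of the prescribed
neighbours. It remains to show that geometrically e.c. graphs on two IC-dense sets are isomorphic,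
which goes by back and forth.

Each finite partial isomorphism carries a chain of matched intervals cutting both copies of [0,1].
On matched intervals, corresponding integer-shifted differences f - g - k agree in sign at the
endpoints and in having zeros, and up to sign at most one has a zero. Since ‖f - g‖ < 1 means that f
- g + 1 and g - f + 1 are positive, the chain preserves proximity.

To add v, the chain is refined until v and the old functions have at most one crossing per interval;
disjointness of crossing sets and compactness allow this. Copying the cuts to the other side is
where infinite crossing enters: near a zero the difference takes both signs again and again, so a
cut can realize any consistent pattern of sign and zeros (`Oscillates.exists_split`). On each small
interval finitely many strict inequalities then make w copy the position of v. They glue to an open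
region with convex fibres, hence to a nonempty open set of admissible w, where the e.c. property
supplies a vertex with the right adjacencies. -/

/-! ### Random graphs on dense sets are geometrically e.c. -/

/-- Among infinitely many boxes with pairwise disjoint finite supports and probabilities bounded
below, almost surely at least one occurs. -/
lemma ae_exists_forall_mem_of_disjoint {ι : Type*} {X : ι → Type*} [∀ i, MeasurableSpace (X i)]
    (μ : ∀ i, Measure (X i)) [∀ i, IsProbabilityMeasure (μ i)] (s : ℕ → Finset ι)
    (hs : Pairwise (Function.onFun Disjoint s)) (t : ∀ i, Set (X i))
    (ht : ∀ i, MeasurableSet (t i)) {c : ENNReal} (hc : c ≠ 0)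
    (h : ∀ n, c ≤ ∏ i ∈ s n, μ i (t i)) :
    ∀ᵐ x ∂(Measure.infinitePi μ), ∃ n, ∀ i ∈ s n, x i ∈ t i := by
  classical
  set E : ℕ → Set (∀ i, X i) := fun n ↦ (s n : Set ι).pi t
  have hE (n : ℕ) : MeasurableSet (E n) :=
    MeasurableSet.pi (s n).countable_toSet fun i _ ↦ ht i
  have hμE (n : ℕ) : Measure.infinitePi μ (E n) = ∏ i ∈ s n, μ i (t i) :=
    Measure.infinitePi_pi μ fun i _ ↦ ht i
  have hind : iIndepSet E (Measure.infinitePi μ) := by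
    rw [iIndepSet_iff_meas_biInter hE]
    intro F
    have : ⋂ n ∈ F, E n = ((F.biUnion s : Finset ι) : Set ι).pi t := by
      ext x
      simp only [E, Set.mem_iInter, Set.mem_pi, Finset.coe_biUnion, Set.mem_iUnion]
      grind
    rw [this, Measure.infinitePi_pi μ fun i _ ↦ ht i, Finset.prod_biUnion]
    · exact Finset.prod_congr rfl fun n _ ↦ (hμE n).symm
    · exact fun m _ n _ hmn ↦ hs hmn
  have hsum : ∑' n, Measure.infinitePi μ (E n) = ⊤ :=
    top_le_iff.1 <| (ENNReal.tsum_const_eq_top_of_ne_zero (α := ℕ) hc).symm.le.trans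
      (ENNReal.tsum_le_tsum fun n ↦ (h n).trans (hμE n).ge)
  -- Second Borel–Cantelli lemma.
  have h1 := measure_limsup_eq_one hE hind hsum
  have h2 : ∀ᵐ x ∂(Measure.infinitePi μ), x ∈ limsup E atTop :=
    (prob_compl_eq_zero_iff (MeasurableSet.measurableSet_limsup hE)).2 h1
  filter_upwards [h2] with x hx
  rw [limsup_eq_iInf_iSup_of_nat] at hx
  simp only [Set.iInf_eq_iInter, Set.iSup_eq_iUnion, Set.mem_iInter, Set.mem_iUnion] at hx
  obtain ⟨n, -, hn⟩ := hx 0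
  exact ⟨n, fun i hi ↦ hn i hi⟩

/-- Geometric existential closedness (with threshold `1`) of a graph on a subset of a normed
space. -/
structure IsGeometricEC {X : Type*} [NormedAddCommGroup X] {V : Set X} (G : SimpleGraph V) :
    Prop where
  le_proximityGraph : G ≤ proximityGraph V
  exists_adj_iff : ∀ U : Set X, IsOpen U → U.Nonempty → ∀ S T : Finset V, T ⊆ S →
    (∀ w : V, (w : X) ∈ U → ∀ u ∈ T, ‖(w : X) - u‖ < 1) →
      ∃ w : V, (w : X) ∈ U ∧ w ∉ S ∧ ∀ u ∈ S, (G.Adj w u ↔ u ∈ T)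

section

variable {X : Type*} [NormedAddCommGroup X] {V : Set X} {p : unitInterval}

/-- Stars at different centres use disjoint sets of pairs, and each has the required shape with
probability at least min(p, 1 - p)^|S|. Only the pairs towards `T` must belong to `E`, since absence
has probability at least 1 - p in any case. -/
lemma ae_setBernoulli_exists_star {W : Type*} [Countable W] (E : Set (Sym2 W)) (hp0 : 0 < p) (hp1 : p < 1)
    (S T : Finset W) (hT : T ⊆ S) (w : ℕ → W) (hw : Function.Injective w) (hwS : ∀ n, w n ∉ S)
    (hE : ∀ n, ∀ u ∈ T, s(w n, u) ∈ E) :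
    ∀ᵐ s ∂(setBernoulli E p), ∃ n, ∀ u ∈ S, (s(w n, u) ∈ s ↔ u ∈ T) := by
  classical
  have hmeas : MeasurableSet {s : Set (Sym2 W) | ∃ n, ∀ u ∈ S, (s(w n, u) ∈ s ↔ u ∈ T)} := by
    refine measurableSet_setOfPred.2 (.exists fun n ↦ ?_)
    refine Measurable.forall fun u ↦ .imp ?_ (.iff ?_ ?_) <;> fun_prop
  rw [setBernoulli_eq_map, ae_map_iff (by fun_prop) hmeas]
  -- The required status of each pair: `s(w n, u)` meets `T` exactly when `u ∈ T`, because `w n`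
  -- lies outside `S`.
  set t : Sym2 W → Set Prop := fun e ↦ if ∃ u ∈ T, u ∈ e then {True} else {False}
  set c : ENNReal := min (unitInterval.toNNReal p) (unitInterval.toNNReal (unitInterval.symm p))
  have hc0 : c ≠ 0 := by
    have h0 : (0 : NNReal) < unitInterval.toNNReal p := hp0
    have h1 : (0 : NNReal) < unitInterval.toNNReal (unitInterval.symm p) := by
      rw [← NNReal.coe_pos]
      exact sub_pos.2 (show (p : ℝ) < 1 from hp1)
    exact (lt_min (ENNReal.coe_pos.2 h0) (ENNReal.coe_pos.2 h1)).ne'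
  have hc1 : c ≤ 1 := by
    refine (min_le_left _ _).trans ?_
    exact_mod_cast p.2.2
  have key := ae_exists_forall_mem_of_disjoint
    (fun i : Sym2 W ↦ unitInterval.toNNReal p • Measure.dirac (i ∈ E) +
      unitInterval.toNNReal (unitInterval.symm p) • Measure.dirac False)
    (fun n ↦ S.image fun u ↦ s(w n, u)) ?_ t (fun _ ↦ .of_discrete) (c := c ^ S.card)
    (pow_ne_zero _ hc0) ?_
  · filter_upwards [key] with x ⟨n, hn⟩
    refine ⟨n, fun u hu ↦ ?_⟩
    have := hn _ (Finset.mem_image_of_mem _ hu)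
    have hiff : (∃ u' ∈ T, u' ∈ s(w n, u)) ↔ u ∈ T := by
      constructor
      · rintro ⟨u', hu', h⟩
        rcases Sym2.mem_iff.1 h with rfl | rfl
        · exact absurd (hT hu') (hwS n)
        · exact hu'
      · exact fun h ↦ ⟨u, h, Sym2.mem_mk_right _ _⟩
    simp only [t, hiff] at this
    split_ifs at this with h <;> simp_all
  · intro m n hmn
    simp only [Function.onFun, Finset.disjoint_left, Finset.mem_image]
    rintro _ ⟨u, hu, rfl⟩ ⟨u', hu', h⟩
    rcases Sym2.eq_iff.1 h with ⟨h, -⟩ | ⟨h, -⟩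
    · exact hmn (hw h.symm)
    · exact hwS n (h ▸ hu)
  · intro n
    calc c ^ S.card ≤ c ^ (S.image fun u ↦ s(w n, u)).card :=
          pow_le_pow_right_of_le_one' hc1 Finset.card_image_le
      _ ≤ _ := Finset.pow_card_le_prod _ _ _ ?_
    intro e he
    obtain ⟨u, hu, rfl⟩ := Finset.mem_image.1 he
    simp only [t]
    split_ifs with h
    · obtain ⟨u', hu', h⟩ := h
      have hmem : s(w n, u) ∈ E := by
        rcases Sym2.mem_iff.1 h with rfl | rfl
        · exact absurd (hT hu') (hwS n)
        · exact hE n _ hu'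
      simp [hmem, c]
    · refine (min_le_right _ _).trans ?_
      simp

lemma Dense.infinite_inter_isOpen [NormedSpace ℝ X] [Nontrivial X] (hV : Dense V) {U : Set X}
    (hU : IsOpen U) (hne : U.Nonempty) : (V ∩ U).Infinite := by
  intro hfin
  have : Dense (V \ (V ∩ U)) := by
    have := hV.sdiff_finite hfin
    exact this
  obtain ⟨x, hxU, hxV, hx⟩ := this.inter_open_nonempty U hU hne
  exact hx ⟨hxV, hxU⟩

lemma ae_LARG_exists_star [NormedSpace ℝ X] [Nontrivial X] (hV : Dense V) (hVc : V.Countable)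
    (hp0 : 0 < p) (hp1 : p < 1) {U : Set X} (hU : IsOpen U) (hne : U.Nonempty)
    {S T : Finset V} (hT : T ⊆ S) (hUT : ∀ w : V, (w : X) ∈ U → ∀ u ∈ T, ‖(w : X) - u‖ < 1) :
    ∀ᵐ G ∂(LARG V p), ∃ w : V, (w : X) ∈ U ∧ w ∉ S ∧ ∀ u ∈ S, (G.Adj w u ↔ u ∈ T) := by
  classical
  have : Countable V := hVc
  have hinf : {w : V | (w : X) ∈ U ∧ w ∉ S}.Infinite := by
    intro hfin
    apply hV.infinite_inter_isOpen hU hne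
    refine ((hfin.union S.finite_toSet).image (Subtype.val)).subset ?_
    rintro x ⟨hxV, hxU⟩
    refine ⟨⟨x, hxV⟩, ?_, rfl⟩
    by_cases h : (⟨x, hxV⟩ : V) ∈ S
    · exact .inr h
    · exact .inl ⟨hxU, h⟩
  set w : ℕ → V := fun n ↦ (hinf.natEmbedding _ n).1
  have hwU (n : ℕ) : (w n : X) ∈ U ∧ w n ∉ S := (hinf.natEmbedding _ n).2
  have hwinj : Function.Injective w :=
    Subtype.val_injective.comp (hinf.natEmbedding _).injective
  have hmeas : MeasurableSet {G : SimpleGraph V |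
      ∃ w : V, (w : X) ∈ U ∧ w ∉ S ∧ ∀ u ∈ S, (G.Adj w u ↔ u ∈ T)} := by
    refine measurableSet_setOfPred.2 (.exists fun n ↦ ?_)
    refine .and (by fun_prop) (.and (by fun_prop) ?_)
    refine Measurable.forall fun u ↦ .imp ?_ (.iff ?_ ?_) <;> fun_prop
  rw [LARG, ae_map_iff SimpleGraph.measurable_fromEdgeSet.aemeasurable hmeas]
  have hne' (n : ℕ) (u : V) (hu : u ∈ S) : w n ≠ u := fun h ↦ (hwU n).2 (h ▸ hu)
  filter_upwards [ae_setBernoulli_exists_star (proximityGraph V).edgeSet hp0 hp1 S T hT w hwinj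
    (fun n ↦ (hwU n).2) fun n u hu ↦ ⟨hne' n u (hT hu), hUT _ (hwU n).1 u hu⟩] with s ⟨n, hn⟩
  refine ⟨w n, (hwU n).1, (hwU n).2, fun u hu ↦ ?_⟩
  simp [SimpleGraph.fromEdgeSet_adj, hn u hu, hne' n u hu]

/-- Almost every local area random graph on a countable dense set is geometrically e.c. -/
theorem ae_LARG_isGeometricEC [NormedSpace ℝ X] [Nontrivial X] (hV : Dense V)
    (hVc : V.Countable) (hp0 : 0 < p) (hp1 : p < 1) : ∀ᵐ G ∂(LARG V p), IsGeometricEC G := by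
  have : Countable V := hVc
  -- Countably many balls centred in `V` suffice: the distance condition on an open set passes to
  -- any ball inside it.
  have h1 : ∀ᵐ G ∂(LARG V p), ∀ (c : V) (n : ℕ) (S T : Finset V), T ⊆ S →
      (∀ w : V, (w : X) ∈ Metric.ball (c : X) (1 / (n + 1)) → ∀ u ∈ T, ‖(w : X) - u‖ < 1) →
      ∃ w : V, (w : X) ∈ Metric.ball (c : X) (1 / (n + 1)) ∧ w ∉ S ∧
        ∀ u ∈ S, (G.Adj w u ↔ u ∈ T) := by
    simp only [ae_all_iff]
    intro c n S T hT hUT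
    exact ae_LARG_exists_star hV hVc hp0 hp1 Metric.isOpen_ball
      ⟨c, Metric.mem_ball_self (by positivity)⟩ hT hUT
  have h2 : ∀ᵐ G ∂(LARG V p), G ≤ proximityGraph V := by
    have hmeas : MeasurableSet {G : SimpleGraph V | G ≤ proximityGraph V} := by
      have : {G : SimpleGraph V | G ≤ proximityGraph V} =
          {G | ∀ u v, G.Adj u v → (proximityGraph V).Adj u v} := by
        ext G
        rfl
      rw [this]
      refine measurableSet_setOfPred.2 (.forall fun u ↦ .forall fun v ↦ .imp ?_ ?_) <;> fun_prop
    rw [LARG, ae_map_iff SimpleGraph.measurable_fromEdgeSet.aemeasurable hmeas]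
    filter_upwards [setBernoulli_ae_subset] with s hs u v huv
    exact hs huv.1
  filter_upwards [h1, h2] with G hG hle
  refine ⟨hle, fun U hU ⟨x, hx⟩ S T hT hUT ↦ ?_⟩
  obtain ⟨c, hcU, hcV⟩ := hV.inter_open_nonempty U hU ⟨x, hx⟩
  obtain ⟨ε, hε, hεU⟩ := Metric.isOpen_iff.1 hU c hcU
  obtain ⟨n, hn⟩ := exists_nat_one_div_lt hε
  have hsub : Metric.ball c (1 / ((n : ℝ) + 1)) ⊆ U := (Metric.ball_subset_ball hn.le).trans hεU
  obtain ⟨w, hw, hwS, hadj⟩ := hG ⟨c, hcV⟩ n S T hT fun w hw ↦ hUT w (hsub hw)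
  exact ⟨w, hsub hw, hwS, hadj⟩

end

/-! ### Back and forth -/

/-- Back-and-forth construction of a bijection all of whose pairs of values lie in a common finite
partial bijection from a family with the extension property. -/
theorem exists_equiv_of_backAndForth {α β : Type*} [Countable α] [Countable β]
    [DecidableEq α] [DecidableEq β] (P : Finset (α × β) → Prop)
    (hinj : ∀ A, P A → ∀ x ∈ A, ∀ y ∈ A, (x.1 = y.1 ↔ x.2 = y.2)) (h0 : P ∅)
    (forth : ∀ A, P A → ∀ a, ∃ B, A ⊆ B ∧ P B ∧ ∃ b, (a, b) ∈ B)
    (back : ∀ A, P A → ∀ b, ∃ B, A ⊆ B ∧ P B ∧ ∃ a, (a, b) ∈ B) :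
    ∃ e : α ≃ β, ∀ a a', ∃ A, P A ∧ (a, e a) ∈ A ∧ (a', e a') ∈ A := by
  classical
  have : Encodable (α ⊕ β) := Encodable.ofCountable _
  -- An ideal meeting all these cofinal sets is directed, and the union of its members is the graph
  -- of a bijection.
  let 𝒟 : α ⊕ β → Order.Cofinal {A : Finset (α × β) // P A} := fun
    | .inl a => ⟨{A | ∃ b, (a, b) ∈ A.1}, fun A ↦ by
        obtain ⟨B, hAB, hB, hb⟩ := forth A.1 A.2 a
        exact ⟨⟨B, hB⟩, hb, hAB⟩⟩
    | .inr b => ⟨{A | ∃ a, (a, b) ∈ A.1}, fun A ↦ by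
        obtain ⟨B, hAB, hB, hb⟩ := back A.1 A.2 b
        exact ⟨⟨B, hB⟩, hb, hAB⟩⟩
  let J := Order.idealOfCofinals ⟨∅, h0⟩ 𝒟
  have hl (a : α) : ∃ b, ∃ A ∈ J, (a, b) ∈ A.1 := by
    obtain ⟨A, ⟨b, hb⟩, hA⟩ := Order.cofinal_meets_idealOfCofinals ⟨∅, h0⟩ 𝒟 (.inl a)
    exact ⟨b, A, hA, hb⟩
  have hr (b : β) : ∃ a, ∃ A ∈ J, (a, b) ∈ A.1 := by
    obtain ⟨A, ⟨b, hb⟩, hA⟩ := Order.cofinal_meets_idealOfCofinals ⟨∅, h0⟩ 𝒟 (.inr b)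
    exact ⟨b, A, hA, hb⟩
  have hdir {x y : α × β} (hx : ∃ A ∈ J, x ∈ A.1) (hy : ∃ A ∈ J, y ∈ A.1) :
      ∃ A, P A ∧ x ∈ A ∧ y ∈ A := by
    obtain ⟨A, hA, hx⟩ := hx
    obtain ⟨B, hB, hy⟩ := hy
    obtain ⟨C, -, hAC, hBC⟩ := J.directed A hA B hB
    exact ⟨C.1, C.2, hAC hx, hBC hy⟩
  choose f hf using hl
  choose g hg using hr
  refine ⟨⟨f, g, fun a ↦ ?_, fun b ↦ ?_⟩, fun a a' ↦ hdir (hf a) (hf a')⟩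
  · obtain ⟨A, hA, h1, h2⟩ := hdir (hf a) (hg (f a))
    exact ((hinj A hA _ h1 _ h2).2 rfl).symm
  · obtain ⟨A, hA, h1, h2⟩ := hdir (hg b) (hf (g b))
    exact ((hinj A hA _ h1 _ h2).1 rfl).symm

/-! ### Crossings, regular points and oscillation -/

lemma mem_crossingSet_iff {f g : C(unitInterval, ℝ)} {x : unitInterval} :
    x ∈ crossingSet f g ↔ ∃ k : ℤ, f x - g x = k :=
  Int.fract_eq_fract

/-- Points of the unit interval at which no two distinct functions of `V` cross. -/
def regularPoints (V : Set C(unitInterval, ℝ)) : Set unitInterval :=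
  {x | ∀ f ∈ V, ∀ g ∈ V, f ≠ g → x ∉ crossingSet f g}

lemma sub_ne_of_mem_regularPoints {V : Set C(unitInterval, ℝ)} {x : unitInterval}
    (hx : x ∈ regularPoints V) {f g : C(unitInterval, ℝ)} (hf : f ∈ V) (hg : g ∈ V) (hfg : f ≠ g)
    (k : ℤ) : f x - g x ≠ k :=
  fun h ↦ hx f hf g hg hfg (mem_crossingSet_iff.2 ⟨k, h⟩)

/-- The integers other than `φ x` form a closed set, which nearby values avoid. Thus a difference
reaches near `x` no integer level except one attained at `x`. -/
lemma eventually_forall_eq_intCast {X : Type*} [TopologicalSpace X] {φ : X → ℝ} {x : X}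
    (hφ : ContinuousAt φ x) : ∀ᶠ y in 𝓝 x, ∀ k : ℤ, φ y = k → φ x = k := by
  have hcl : IsClosed ((fun k : ℤ ↦ (k : ℝ)) '' {k | φ x ≠ k}) :=
    Int.isClosedEmbedding_coe_real.isClosedMap _ (isClosed_discrete _)
  have hx : φ x ∈ ((fun k : ℤ ↦ (k : ℝ)) '' {k | φ x ≠ k})ᶜ := by
    rintro ⟨k, hk, h⟩
    exact hk h.symm
  filter_upwards [hφ.preimage_mem_nhds (hcl.isOpen_compl.mem_nhds hx)] with y hy k hk
  by_contra h
  exact hy ⟨k, h, hk.symm⟩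

/-- Every zero of `d` is, on one of its two sides, a limit of points where `d` is negative and of
points where `d` is positive. -/
def Oscillates (d : C(unitInterval, ℝ)) : Prop :=
  ∀ x, d x = 0 → ((∃ᶠ y in 𝓝[<] x, d y < 0) ∧ ∃ᶠ y in 𝓝[<] x, 0 < d y) ∨
    ((∃ᶠ y in 𝓝[>] x, d y < 0) ∧ ∃ᶠ y in 𝓝[>] x, 0 < d y)

namespace IsICDense

variable {V : Set C(unitInterval, ℝ)}

/-- Strict inequalities keep the sequence off `x`, so monotonicity puts it on a single side; its
even and odd terms give the two signs there. -/
lemma oscillates (hV : IsICDense V) {f g : C(unitInterval, ℝ)} (hf : f ∈ V) (hg : g ∈ V)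
    (hfg : f ≠ g) (k : ℤ) : Oscillates (f - g - (k : C(unitInterval, ℝ))) := by
  intro x hx
  have hxk : f x - g x = k := by simpa [sub_eq_zero] using hx
  obtain ⟨u, hu, hux, hneg, hpos⟩ := hV.infinite_crossing f hf g hg hfg x
    (mem_crossingSet_iff.2 ⟨k, hxk⟩)
  have hne (n : ℕ) : u n ≠ x := by
    intro h
    obtain ⟨m, rfl | rfl⟩ := n.even_or_odd'
    · exact (hneg m).ne (by rw [h])
    · exact (hpos m).ne' (by rw [h])
  have h2 : Tendsto (fun n : ℕ ↦ 2 * n) atTop atTop :=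
    tendsto_atTop_mono (fun n ↦ by grind) tendsto_id
  have h3 : Tendsto (fun n : ℕ ↦ 2 * n + 1) atTop atTop := 
    tendsto_atTop_mono (fun n ↦ by grind) tendsto_id
  have key (l : Filter unitInterval) (hl : Tendsto u atTop l) :
      (∃ᶠ y in l, (f - g - (k : C(unitInterval, ℝ))) y < 0) ∧
        ∃ᶠ y in l, 0 < (f - g - (k : C(unitInterval, ℝ))) y := by
    refine ⟨(hl.comp h2).frequently (.of_forall fun n ↦ ?_),
      (hl.comp h3).frequently (.of_forall fun n ↦ ?_)⟩
    · have := hneg n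
      simp only [Function.comp_apply, ContinuousMap.sub_apply, ContinuousMap.intCast_apply]
      linarith
    · have := hpos n
      simp only [Function.comp_apply, ContinuousMap.sub_apply, ContinuousMap.intCast_apply]
      linarith
  rcases hu with hu | hu
  · exact .inl <| key _ <| tendsto_nhdsWithin_iff.2
      ⟨hux, .of_forall fun n ↦ lt_of_le_of_ne (hu.ge_of_tendsto hux n) (hne n)⟩
  · exact .inr <| key _ <| tendsto_nhdsWithin_iff.2
      ⟨hux, .of_forall fun n ↦ lt_of_le_of_ne (hu.le_of_tendsto hux n) (hne n).symm⟩

lemma isOpen_compl_crossingSet (f g : C(unitInterval, ℝ)) : IsOpen (crossingSet f g)ᶜ := by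
  have : crossingSet f g = (fun x ↦ f x - g x) ⁻¹' Set.range (fun k : ℤ ↦ (k : ℝ)) := by
    ext x
    simp [mem_crossingSet_iff, eq_comm]
  rw [this, isOpen_compl_iff]
  exact Int.isClosedEmbedding_coe_real.isClosed_range.preimage (by fun_prop)

/-- Arbitrarily near a crossing, the difference lies strictly below its level, and close enough no
other integer level is available. -/
lemma dense_compl_crossingSet (hV : IsICDense V) {f g : C(unitInterval, ℝ)} (hf : f ∈ V)
    (hg : g ∈ V) (hfg : f ≠ g) : Dense (crossingSet f g)ᶜ := by
  intro x
  by_cases hx : x ∈ crossingSet f g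
  · obtain ⟨k, hk⟩ := mem_crossingSet_iff.1 hx
    have hfr : ∃ᶠ y in 𝓝 x, (f - g - (k : C(unitInterval, ℝ))) y < 0 := by
      rcases hV.oscillates hf hg hfg k x (by simp [hk]) with h | h
      · exact h.1.filter_mono nhdsWithin_le_nhds
      · exact h.1.filter_mono nhdsWithin_le_nhds
    rw [mem_closure_iff_frequently]
    refine (hfr.and_eventually (eventually_forall_eq_intCast
      (φ := fun y ↦ f y - g y) (x := x) (by fun_prop))).mono ?_
    rintro y ⟨hy, hyk⟩ hmem
    obtain ⟨l, hl⟩ := mem_crossingSet_iff.1 hmem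
    have h1 := hyk l hl
    simp only [ContinuousMap.sub_apply, ContinuousMap.intCast_apply] at hy
    linarith
  · exact subset_closure hx

/-- Baire category: there are countably many pairs, each with closed nowhere dense crossing set. -/
lemma dense_regularPoints (hV : IsICDense V) : Dense (regularPoints V) := by
  have : regularPoints V = ⋂ e ∈ {e : C(unitInterval, ℝ) × C(unitInterval, ℝ) |
      e ∈ V ×ˢ V ∧ e.1 ≠ e.2}, (crossingSet e.1 e.2)ᶜ := by
    ext x
    simp only [regularPoints, Set.mem_iInter, Set.mem_ofPred_eq, Prod.forall, Set.mem_prod,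
      Set.mem_compl_iff]
    grind
  rw [this]
  refine dense_biInter_of_isOpen (fun e _ ↦ isOpen_compl_crossingSet _ _) ?_
    fun e he ↦ hV.dense_compl_crossingSet he.1.1 he.1.2 he.2
  exact (hV.countable.prod hV.countable).mono fun e he ↦ he.1

lemma zero_mem_regularPoints (hV : IsICDense V) : 0 ∈ regularPoints V :=
  hV.zero_notMem_crossingSet

lemma one_mem_regularPoints (hV : IsICDense V) : 1 ∈ regularPoints V :=
  hV.one_notMem_crossingSet

/-- Two crossings at a common point come from the same pair of functions and the same integer
level. -/
lemma eq_of_sub_eq_intCast (hV : IsICDense V) {f g h l : C(unitInterval, ℝ)} (hf : f ∈ V)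
    (hg : g ∈ V) (hh : h ∈ V) (hl : l ∈ V) (hfg : f ≠ g) (hhl : h ≠ l) {k m : ℤ}
    {x : unitInterval} (hk : f x - g x = k) (hm : h x - l x = m) :
    (h = f ∧ l = g ∧ m = k) ∨ (h = g ∧ l = f ∧ m = -k) := by
  have : s(f, g) = s(h, l) := by
    by_contra hne
    exact Set.disjoint_left.1 (hV.disjoint_crossingSet f hf g hg h hh l hl hfg hhl hne)
      (mem_crossingSet_iff.2 ⟨k, hk⟩) (mem_crossingSet_iff.2 ⟨m, hm⟩)
  rcases Sym2.eq_iff.1 this with ⟨rfl, rfl⟩ | ⟨rfl, rfl⟩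
  · exact .inl ⟨rfl, rfl, by exact_mod_cast hm.symm.trans hk⟩
  · refine .inr ⟨rfl, rfl, ?_⟩
    have : (m : ℝ) = -k := by linarith
    exact_mod_cast this

end IsICDense

/-! ### Cutting an interval with prescribed signs and zeros -/

lemma pos_iff_of_forall_ne_zero {d : C(unitInterval, ℝ)} {a b : unitInterval}
    (h : ∀ x ∈ Set.Icc a b, d x ≠ 0) {x y : unitInterval} (hx : x ∈ Set.Icc a b)
    (hy : y ∈ Set.Icc a b) : 0 < d x ↔ 0 < d y := by
  have key : ∀ x ∈ Set.Icc a b, ∀ y ∈ Set.Icc a b, 0 < d x → 0 < d y := by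
    intro x hx y hy hpos
    by_contra hneg
    obtain ⟨z, hz, hz0⟩ := isPreconnected_Icc.intermediate_value hy hx
      d.continuous.continuousOn ⟨not_lt.1 hneg, hpos.le⟩
    exact h z hz hz0
  exact ⟨key x hx y hy, key y hy x hx⟩

lemma exists_zero_of_pos_iff {d : C(unitInterval, ℝ)} {a b : unitInterval} (hab : a ≤ b)
    (h : ¬(0 < d a ↔ 0 < d b)) : ∃ x ∈ Set.Icc a b, d x = 0 := by
  by_contra! hne
  exact h (pos_iff_of_forall_ne_zero hne (Set.left_mem_Icc.2 hab) (Set.right_mem_Icc.2 hab))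

/-- An oscillating function realizes every consistent combination of sign at, and existence of
zeros to the left and to the right of, an intermediate point. -/
lemma Oscillates.exists_split {d : C(unitInterval, ℝ)} (hd : Oscillates d) {D : Set unitInterval}
    (hD : Dense D) (hdD : ∀ x ∈ D, d x ≠ 0) {a b : unitInterval} (hab : a < b) (ha : a ∈ D)
    (hb : b ∈ D) {c₁ c₂ σ : Prop} (hc : (c₁ ∨ c₂) ↔ ∃ x ∈ Set.Icc a b, d x = 0)
    (hc₁ : ¬c₁ → (σ ↔ 0 < d a)) (hc₂ : ¬c₂ → (σ ↔ 0 < d b)) :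
    ∃ u ∈ D, a < u ∧ u < b ∧ (0 < d u ↔ σ) ∧ ((∃ x ∈ Set.Icc a u, d x = 0) ↔ c₁) ∧
      ((∃ x ∈ Set.Icc u b, d x = 0) ↔ c₂) := by
  have hmeet {x y : unitInterval} (hxy : x < y) : ∃ u ∈ D, x < u ∧ u < y := by
    obtain ⟨u, hu, huD⟩ := hD.inter_open_nonempty _ isOpen_Ioo (Set.nonempty_Ioo.2 hxy)
    exact ⟨u, huD, hu.1, hu.2⟩
  -- If no zero is wanted on the left, cut so close to `a` that `d` has no zero before the cut; all
  -- zeros stay on the right. The case of `c₂` mirrors this near `b`.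
  by_cases h₁ : c₁
  swap
  · have hev : ∀ᶠ x in 𝓝[≥] a, d x ≠ 0 :=
      (d.continuous.continuousAt.eventually_ne (hdD a ha)).filter_mono nhdsWithin_le_nhds
    obtain ⟨v, hv, hvs⟩ := (mem_nhdsGE_iff_exists_mem_Ioc_Ico_subset hab).1 hev
    obtain ⟨u, huD, hau, huv⟩ := hmeet hv.1
    have hne : ∀ x ∈ Set.Icc a u, d x ≠ 0 := fun x hx ↦ hvs ⟨hx.1, hx.2.trans_lt huv⟩
    refine ⟨u, huD, hau, huv.trans_le hv.2, ?_, ?_, ?_⟩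
    · rw [hc₁ h₁]
      exact pos_iff_of_forall_ne_zero hne (Set.right_mem_Icc.2 hau.le) (Set.left_mem_Icc.2 hau.le)
    · simpa [h₁] using hne
    · rw [← or_iff_right h₁ (b := c₂), hc]
      refine ⟨fun ⟨x, hx, h⟩ ↦ ⟨x, ⟨hau.le.trans hx.1, hx.2⟩, h⟩, fun ⟨x, hx, h⟩ ↦
        ⟨x, ⟨?_, hx.2⟩, h⟩⟩
      by_contra hlt
      exact hne x ⟨hx.1, (not_le.1 hlt).le⟩ h
  by_cases h₂ : c₂
  swap
  · have hev : ∀ᶠ x in 𝓝[≤] b, d x ≠ 0 :=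
      (d.continuous.continuousAt.eventually_ne (hdD b hb)).filter_mono nhdsWithin_le_nhds
    obtain ⟨v, hv, hvs⟩ := (mem_nhdsLE_iff_exists_mem_Ico_Ioc_subset hab).1 hev
    obtain ⟨u, huD, hvu, hub⟩ := hmeet hv.2
    have hne : ∀ x ∈ Set.Icc u b, d x ≠ 0 := fun x hx ↦ hvs ⟨hvu.trans_le hx.1, hx.2⟩
    refine ⟨u, huD, hv.1.trans_lt hvu, hub, ?_, ?_, ?_⟩
    · rw [hc₂ h₂]
      exact pos_iff_of_forall_ne_zero hne (Set.left_mem_Icc.2 hub.le) (Set.right_mem_Icc.2 hub.le)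
    · rw [← or_iff_left h₂ (a := c₁), hc]
      refine ⟨fun ⟨x, hx, h⟩ ↦ ⟨x, ⟨hx.1, hx.2.trans hub.le⟩, h⟩, fun ⟨x, hx, h⟩ ↦
        ⟨x, ⟨hx.1, ?_⟩, h⟩⟩
      by_contra hlt
      exact hne x ⟨(not_le.1 hlt).le, hx.2⟩ h
    · simpa [h₂] using hne
  -- With zeros wanted on both sides, cut on the oscillating side of a zero `x`, which serves one
  -- part. A point `y` between the cut and the far endpoint, where the sign differs from that
  -- endpoint's, yields a zero in the other part.
  obtain ⟨x, hx, hx0⟩ := hc.1 (.inl h₁)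
  have hax : a < x := lt_of_le_of_ne hx.1 fun h ↦ hdD a ha (h ▸ hx0)
  have hxb : x < b := lt_of_le_of_ne hx.2 fun h ↦ hdD b hb (h ▸ hx0)
  have hneg : IsOpen {y | d y < 0} := isOpen_lt d.continuous continuous_const
  have hpos : IsOpen {y | 0 < d y} := isOpen_lt continuous_const d.continuous
  simp only [h₁, h₂, iff_true]
  rcases hd x hx0 with ⟨hn, hp⟩ | ⟨hn, hp⟩
  · have pick (c : unitInterval) (hcx : c < x) (s : Prop) :
        ∃ u ∈ D, c < u ∧ u < x ∧ (0 < d u ↔ s) := by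
      have hev : ∀ᶠ y in 𝓝[<] x, y ∈ Set.Ioo c x := Ioo_mem_nhdsLT hcx
      by_cases hs : s
      · obtain ⟨y, hy, hyc⟩ := (hp.and_eventually hev).exists
        obtain ⟨u, hu, huD⟩ := hD.inter_open_nonempty _ (hpos.inter isOpen_Ioo) ⟨y, hy, hyc⟩
        exact ⟨u, huD, hu.2.1, hu.2.2, iff_of_true hu.1 hs⟩
      · obtain ⟨y, hy, hyc⟩ := (hn.and_eventually hev).exists
        obtain ⟨u, hu, huD⟩ := hD.inter_open_nonempty _ (hneg.inter isOpen_Ioo) ⟨y, hy, hyc⟩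
        exact ⟨u, huD, hu.2.1, hu.2.2, iff_of_false (not_lt.2 (le_of_lt hu.1)) hs⟩
    obtain ⟨y, -, hay, hyx, hy⟩ := pick a hax (¬0 < d a)
    obtain ⟨u, huD, hyu, hux, hu⟩ := pick y hyx σ
    refine ⟨u, huD, hay.trans hyu, hux.trans hxb, hu, ?_, x, ⟨hux.le, hxb.le⟩, hx0⟩
    obtain ⟨z, hz, hz0⟩ := exists_zero_of_pos_iff hay.le (d := d) (by tauto)
    exact ⟨z, ⟨hz.1, hz.2.trans hyu.le⟩, hz0⟩
  · have pick (c : unitInterval) (hcx : x < c) (s : Prop) :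
        ∃ u ∈ D, x < u ∧ u < c ∧ (0 < d u ↔ s) := by
      have hev : ∀ᶠ y in 𝓝[>] x, y ∈ Set.Ioo x c := Ioo_mem_nhdsGT hcx
      by_cases hs : s
      · obtain ⟨y, hy, hyc⟩ := (hp.and_eventually hev).exists
        obtain ⟨u, hu, huD⟩ := hD.inter_open_nonempty _ (hpos.inter isOpen_Ioo) ⟨y, hy, hyc⟩
        exact ⟨u, huD, hu.2.1, hu.2.2, iff_of_true hu.1 hs⟩
      · obtain ⟨y, hy, hyc⟩ := (hn.and_eventually hev).exists
        obtain ⟨u, hu, huD⟩ := hD.inter_open_nonempty _ (hneg.inter isOpen_Ioo) ⟨y, hy, hyc⟩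
        exact ⟨u, huD, hu.2.1, hu.2.2, iff_of_false (not_lt.2 (le_of_lt hu.1)) hs⟩
    obtain ⟨y, -, hxy, hyb, hy⟩ := pick b hxb (¬0 < d b)
    obtain ⟨u, huD, hxu, huy, hu⟩ := pick y hxy σ
    refine ⟨u, huD, hax.trans hxu, huy.trans hyb, hu, ⟨x, ⟨hax.le, hxu.le⟩, hx0⟩, ?_⟩
    obtain ⟨z, hz, hz0⟩ := exists_zero_of_pos_iff hyb.le (d := d) (by tauto)
    exact ⟨z, ⟨huy.le.trans hz.1, hz.2⟩, hz0⟩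

/-! ### Matched intervals and their subdivision -/

/-- Matched intervals `[p.1, q.1]` and `[p.2, q.2]`: corresponding functions (the pairs in `Δ`)
have the same signs at corresponding endpoints, the same ones have zeros, and up to sign at most
one of them has a zero. -/
structure Matched (Δ : Set (C(unitInterval, ℝ) × C(unitInterval, ℝ))) (D D' : Set unitInterval)
    (p q : unitInterval × unitInterval) : Prop where
  fst_lt : p.1 < q.1
  snd_lt : p.2 < q.2
  left_mem : p ∈ D ×ˢ D'
  right_mem : q ∈ D ×ˢ D'
  sign_left : ∀ e ∈ Δ, (0 < e.1 p.1 ↔ 0 < e.2 p.2)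
  sign_right : ∀ e ∈ Δ, (0 < e.1 q.1 ↔ 0 < e.2 q.2)
  exists_zero_iff : ∀ e ∈ Δ, (∃ x ∈ Set.Icc p.1 q.1, e.1 x = 0) ↔ ∃ y ∈ Set.Icc p.2 q.2, e.2 y = 0
  eq_or_eq_neg : ∀ e ∈ Δ, ∀ e' ∈ Δ, (∃ x ∈ Set.Icc p.1 q.1, e.1 x = 0) →
    (∃ x ∈ Set.Icc p.1 q.1, e'.1 x = 0) → e' = e ∨ e' = -e

namespace Matched

variable {Δ : Set (C(unitInterval, ℝ) × C(unitInterval, ℝ))} {D D' : Set unitInterval}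
  {p q : unitInterval × unitInterval}

/-- Only `eq_or_eq_neg` is asymmetric, and `exists_zero_iff` transports it. This symmetry reduces
the back step to the forth step. -/
lemma swap (h : Matched Δ D D' p q) : Matched (Prod.swap ⁻¹' Δ) D' D p.swap q.swap where
  fst_lt := h.snd_lt
  snd_lt := h.fst_lt
  left_mem := h.left_mem.symm
  right_mem := h.right_mem.symm
  sign_left e he := (h.sign_left _ he).symm
  sign_right e he := (h.sign_right _ he).symm
  exists_zero_iff e he := (h.exists_zero_iff _ he).symm
  eq_or_eq_neg e he e' he' h1 h2 := by
    have := h.eq_or_eq_neg _ he _ he' ((h.exists_zero_iff _ he).2 h1)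
      ((h.exists_zero_iff _ he').2 h2)
    simpa [Prod.ext_iff, and_comm] using this

/-- Absence of zeros transfers to the second interval, and the left endpoint then decides the sign.
-/
lemma forall_pos (h : Matched Δ D D' p q) {e : C(unitInterval, ℝ) × C(unitInterval, ℝ)}
    (he : e ∈ Δ) (hpos : ∀ x ∈ Set.Icc p.1 q.1, 0 < e.1 x) :
    ∀ y ∈ Set.Icc p.2 q.2, 0 < e.2 y := by
  have hne : ∀ y ∈ Set.Icc p.2 q.2, e.2 y ≠ 0 := by
    intro y hy h0
    obtain ⟨x, hx, hx0⟩ := (h.exists_zero_iff e he).2 ⟨y, hy, h0⟩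
    exact (hpos x hx).ne' hx0
  intro y hy
  rw [pos_iff_of_forall_ne_zero hne hy (Set.left_mem_Icc.2 h.snd_lt.le), ← h.sign_left e he]
  exact hpos _ (Set.left_mem_Icc.2 h.fst_lt.le)

/-- A matched pair of intervals can be subdivided at any prescribed regular point. -/
lemma exists_split (h : Matched Δ D D' p q) (hD' : Dense D') (hΔ : ∀ e ∈ Δ, ∀ x ∈ D, e.1 x ≠ 0)
    (hΔ' : ∀ e ∈ Δ, ∀ y ∈ D', e.2 y ≠ 0) (hosc : ∀ e ∈ Δ, Oscillates e.2) {u : unitInterval}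
    (hu : u ∈ D) (hpu : p.1 < u) (huq : u < q.1) :
    ∃ u', Matched Δ D D' p (u, u') ∧ Matched Δ D D' (u, u') q := by
  have hu_mem : u ∈ Set.Icc p.1 q.1 := ⟨hpu.le, huq.le⟩
  have hsub₁ : Set.Icc p.1 u ⊆ Set.Icc p.1 q.1 := Set.Icc_subset_Icc_right huq.le
  have hsub₂ : Set.Icc u q.1 ⊆ Set.Icc p.1 q.1 := Set.Icc_subset_Icc_left hpu.le
  set Good : unitInterval → C(unitInterval, ℝ) × C(unitInterval, ℝ) → Prop := fun u' e ↦
    (0 < e.1 u ↔ 0 < e.2 u') ∧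
    ((∃ x ∈ Set.Icc p.1 u, e.1 x = 0) ↔ ∃ y ∈ Set.Icc p.2 u', e.2 y = 0) ∧
    ((∃ x ∈ Set.Icc u q.1, e.1 x = 0) ↔ ∃ y ∈ Set.Icc u' q.2, e.2 y = 0) with hGood
  have key : ∃ u' ∈ D', p.2 < u' ∧ u' < q.2 ∧
      ∀ e ∈ Δ, (∃ x ∈ Set.Icc p.1 q.1, e.1 x = 0) → Good u' e := by
    -- A cut point chosen for one difference with a zero serves all of them, as the others are equal
    -- or opposite to it. Differences without zeros impose nothing on the choice.
    by_cases hex : ∃ e ∈ Δ, ∃ x ∈ Set.Icc p.1 q.1, e.1 x = 0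
    · obtain ⟨e, he, hx⟩ := hex
      obtain ⟨u', hu', hpu', huq', h1, h2, h3⟩ := (hosc e he).exists_split hD' (hΔ' e he) h.snd_lt
        h.left_mem.2 h.right_mem.2 (c₁ := ∃ x ∈ Set.Icc p.1 u, e.1 x = 0)
        (c₂ := ∃ x ∈ Set.Icc u q.1, e.1 x = 0) (σ := 0 < e.1 u) (by
          rw [← h.exists_zero_iff e he]
          constructor
          · rintro (⟨x, hx, h⟩ | ⟨x, hx, h⟩)
            · exact ⟨x, hsub₁ hx, h⟩
            · exact ⟨x, hsub₂ hx, h⟩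
          · rintro ⟨x, hx, h⟩
            rcases le_total x u with hxu | hxu
            · exact .inl ⟨x, ⟨hx.1, hxu⟩, h⟩
            · exact .inr ⟨x, ⟨hxu, hx.2⟩, h⟩)
        (fun hc ↦ by
          push Not at hc
          rw [← h.sign_left e he]
          exact pos_iff_of_forall_ne_zero hc (Set.right_mem_Icc.2 hpu.le)
            (Set.left_mem_Icc.2 hpu.le))
        (fun hc ↦ by
          push Not at hc
          rw [← h.sign_right e he]
          exact pos_iff_of_forall_ne_zero hc (Set.left_mem_Icc.2 huq.le)
            (Set.right_mem_Icc.2 huq.le))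
      refine ⟨u', hu', hpu', huq', fun e' he' hx' ↦ ?_⟩
      rcases h.eq_or_eq_neg e he e' he' hx hx' with rfl | rfl
      · exact ⟨h1.symm, h2.symm, h3.symm⟩
      · refine ⟨?_, by simpa using h2.symm, by simpa using h3.symm⟩
        have n1 := hΔ e he u hu
        have n2 := hΔ' e he u' hu'
        simp only [Prod.fst_neg, Prod.snd_neg, ContinuousMap.neg_apply, Left.neg_pos_iff]
        rw [← not_iff_not, not_lt, not_lt, n1.symm.le_iff_lt, n2.symm.le_iff_lt]
        exact h1.symm
    · obtain ⟨u', hu', huD⟩ := hD'.inter_open_nonempty _ isOpen_Ioo (Set.nonempty_Ioo.2 h.snd_lt)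
      exact ⟨u', huD, hu'.1, hu'.2, fun e he hx ↦ absurd ⟨e, he, hx⟩ hex⟩
  obtain ⟨u', hu'D, hpu', huq', hgood⟩ := key
  have hsub₁' : Set.Icc p.2 u' ⊆ Set.Icc p.2 q.2 := Set.Icc_subset_Icc_right huq'.le
  have hsub₂' : Set.Icc u' q.2 ⊆ Set.Icc p.2 q.2 := Set.Icc_subset_Icc_left hpu'.le
  have hall : ∀ e ∈ Δ, Good u' e := by
    intro e he
    by_cases hx : ∃ x ∈ Set.Icc p.1 q.1, e.1 x = 0
    · exact hgood e he hx
    · have hy := mt (h.exists_zero_iff e he).2 hx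
      push Not at hx hy
      refine ⟨?_, iff_of_false ?_ ?_, iff_of_false ?_ ?_⟩
      · rw [pos_iff_of_forall_ne_zero hx hu_mem (Set.left_mem_Icc.2 h.fst_lt.le),
          h.sign_left e he]
        exact pos_iff_of_forall_ne_zero hy (Set.left_mem_Icc.2 h.snd_lt.le) ⟨hpu'.le, huq'.le⟩
      · exact fun ⟨x, hxm, h0⟩ ↦ hx x (hsub₁ hxm) h0
      · exact fun ⟨x, hxm, h0⟩ ↦ hy x (hsub₁' hxm) h0
      · exact fun ⟨x, hxm, h0⟩ ↦ hx x (hsub₂ hxm) h0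
      · exact fun ⟨x, hxm, h0⟩ ↦ hy x (hsub₂' hxm) h0
  exact ⟨u',
    { fst_lt := hpu
      snd_lt := hpu'
      left_mem := h.left_mem
      right_mem := ⟨hu, hu'D⟩
      sign_left := h.sign_left
      sign_right := fun e he ↦ (hall e he).1
      exists_zero_iff := fun e he ↦ (hall e he).2.1
      eq_or_eq_neg := fun e he e' he' ⟨x, hx, h1⟩ ⟨y, hy, h2⟩ ↦
        h.eq_or_eq_neg e he e' he' ⟨x, hsub₁ hx, h1⟩ ⟨y, hsub₁ hy, h2⟩ },
    { fst_lt := huq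
      snd_lt := huq'
      left_mem := ⟨hu, hu'D⟩
      right_mem := h.right_mem
      sign_left := fun e he ↦ (hall e he).1
      sign_right := h.sign_right
      exists_zero_iff := fun e he ↦ (hall e he).2.2
      eq_or_eq_neg := fun e he e' he' ⟨x, hx, h1⟩ ⟨y, hy, h2⟩ ↦
        h.eq_or_eq_neg e he e' he' ⟨x, hsub₂ hx, h1⟩ ⟨y, hsub₂ hy, h2⟩ }⟩

end Matched

/-! ### Subdivision into intervals with at most one crossing -/

/-- At most one crossing, counted by unordered pair and integer level, between functions of `S`
happens on the interval `[a, b]`. -/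
def UniqueCrossing (S : Set C(unitInterval, ℝ)) (a b : unitInterval) : Prop :=
  ∀ f ∈ S, ∀ g ∈ S, ∀ h ∈ S, ∀ l ∈ S, f ≠ g → h ≠ l → ∀ k m : ℤ, ∀ x ∈ Set.Icc a b,
    ∀ y ∈ Set.Icc a b, f x - g x = k → h y - l y = m →
      (h = f ∧ l = g ∧ m = k) ∨ (h = g ∧ l = f ∧ m = -k)

/-- The unit interval can be subdivided at regular points into intervals with at most one
crossing. -/
lemma IsICDense.transGen_uniqueCrossing {V : Set C(unitInterval, ℝ)} (hV : IsICDense V)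
    {S : Set C(unitInterval, ℝ)} (hS : S.Finite) (hSV : S ⊆ V) {a b : unitInterval} (hab : a < b)
    (hb : b ∈ regularPoints V) :
    Relation.TransGen (fun a b ↦ a < b ∧ b ∈ regularPoints V ∧ UniqueCrossing S a b) a b := by
  have hnhds (x : unitInterval) : ∃ U : Set unitInterval, IsOpen U ∧ x ∈ U ∧
      ∀ f ∈ S, ∀ g ∈ S, ∀ y ∈ U, ∀ k : ℤ, f y - g y = k → f x - g x = k := by
    have hev : ∀ᶠ y in 𝓝 x, ∀ f ∈ S, ∀ g ∈ S, ∀ k : ℤ, f y - g y = k → f x - g x = k := by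
      refine hS.eventually_all.2 fun f _ ↦ hS.eventually_all.2 fun g _ ↦ ?_
      exact eventually_forall_eq_intCast (φ := fun y ↦ f y - g y) (by fun_prop)
    obtain ⟨U, hU, hUo, hxU⟩ := eventually_nhds_iff.1 hev
    exact ⟨U, hUo, hxU, fun f hf g hg y hy ↦ hU y hy f hf g hg⟩
  choose U hUo hxU hU using hnhds
  -- An interval shorter than the Lebesgue number lies in a single `U z`, so all its crossings have
  -- levels attained at `z`, where disjointness of crossing sets leaves only one.
  obtain ⟨δ, hδ, hball⟩ := lebesgue_number_lemma_of_metric isCompact_univ hUo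
    fun x _ ↦ Set.mem_iUnion.2 ⟨x, hxU x⟩
  have hshort {a b : unitInterval} (hlt : (b : ℝ) - a < δ) : UniqueCrossing S a b := by
    obtain ⟨z, hz⟩ := hball a (Set.mem_univ _)
    have hsub : Set.Icc a b ⊆ U z := by
      refine fun y hy ↦ hz ?_
      have h1 : (a : ℝ) ≤ y := hy.1
      have h2 : (y : ℝ) ≤ b := hy.2
      rw [Metric.mem_ball, Subtype.dist_eq, Real.dist_eq, abs_of_nonneg (by linarith)]
      linarith
    intro f hf g hg h hh l hl hfg hhl k m x hx y hy hk hm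
    exact hV.eq_of_sub_eq_intCast (hSV hf) (hSV hg) (hSV hh) (hSV hl) hfg hhl
      (hU z f hf g hg x (hsub hx) k hk) (hU z h hh l hl y (hsub hy) m hm)
  have key (n : ℕ) : ∀ a b : unitInterval, a < b → b ∈ regularPoints V →
      (b : ℝ) - a ≤ n * (δ / 2) → Relation.TransGen
        (fun a b ↦ a < b ∧ b ∈ regularPoints V ∧ UniqueCrossing S a b) a b := by
    induction n with
    | zero =>
      intro a b hab _ hle
      have : (a : ℝ) < b := hab
      simp only [CharP.cast_eq_zero, zero_mul] at hle
      linarith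
    | succ n ih =>
      intro a b hab hb hle
      by_cases hlt : (b : ℝ) - a < δ
      · exact .single ⟨hab, hb, hshort hlt⟩
      · push Not at hlt
        have ha0 : (0 : ℝ) ≤ a := a.2.1
        have hb1 : (b : ℝ) ≤ 1 := b.2.2
        -- Cutting between `a + δ / 2` and `a + δ` makes a piece shorter than `δ` that still uses up
        -- `δ / 2` of the length.
        let c : unitInterval := ⟨a + δ / 2, by positivity, by linarith⟩
        let d : unitInterval := ⟨a + δ, by positivity, by linarith⟩
        have hcd : c < d := show (a : ℝ) + δ / 2 < a + δ by linarith
        obtain ⟨z, hz, hzD⟩ := hV.dense_regularPoints.inter_open_nonempty _ isOpen_Ioo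
          (Set.nonempty_Ioo.2 hcd)
        have h1 : (a : ℝ) + δ / 2 < z := hz.1
        have h2 : (z : ℝ) < a + δ := hz.2
        have haz : a < z := show (a : ℝ) < z by linarith
        have hzb : z < b := show (z : ℝ) < b by linarith
        refine .head ⟨haz, hzD, hshort (by linarith)⟩ (ih z b hzb hb ?_)
        push_cast at hle
        linarith
  obtain ⟨n, hn⟩ := exists_nat_ge (((b : ℝ) - a) / (δ / 2))
  exact key n a b hab hb ((div_le_iff₀ (by positivity)).1 hn)

/-- A chain of matched intervals can be refined along a subdivision of its first coordinates. -/
lemma Matched.transGen_of_transGen {Δ : Set (C(unitInterval, ℝ) × C(unitInterval, ℝ))}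
    {D D' : Set unitInterval} {p q : unitInterval × unitInterval} (hD' : Dense D')
    (hΔ : ∀ e ∈ Δ, ∀ x ∈ D, e.1 x ≠ 0) (hΔ' : ∀ e ∈ Δ, ∀ y ∈ D', e.2 y ≠ 0)
    (hosc : ∀ e ∈ Δ, Oscillates e.2) {Q : unitInterval → unitInterval → Prop}
    (h : Matched Δ D D' p q)
    (hQ : Relation.TransGen (fun a b ↦ a < b ∧ b ∈ D ∧ Q a b) p.1 q.1) :
    Relation.TransGen (fun p q ↦ Matched Δ D D' p q ∧ Q p.1 q.1) p q := by
  have key (a : unitInterval)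
      (hQ : Relation.TransGen (fun a b ↦ a < b ∧ b ∈ D ∧ Q a b) a q.1) :
      ∀ a', Matched Δ D D' (a, a') q →
        Relation.TransGen (fun p q ↦ Matched Δ D D' p q ∧ Q p.1 q.1) (a, a') q := by
    induction hQ using Relation.TransGen.head_induction_on with
    | single h => exact fun a' ha' ↦ .single ⟨ha', h.2.2⟩
    | @head a c h hc ih =>
      intro a' ha'
      have hcq : c < q.1 := Relation.TransGen.trans_induction_on hc (fun h ↦ h.1)
        fun _ _ h1 h2 ↦ h1.trans h2
      obtain ⟨c', h1, h2⟩ := ha'.exists_split hD' hΔ hΔ' hosc h.2.1 h.1 hcq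
      exact .head ⟨h1, h.2.2⟩ (ih c' h2)
  exact key p.1 hQ p.2 h

/-! ### Open regions that force the position of a function -/

/-- The values at `p.2` which compare to the second components of the curves in `K` as `v p.1`
compares to their first components. -/
def transferredValues (K : Set (C(unitInterval, ℝ) × C(unitInterval, ℝ))) (v : C(unitInterval, ℝ))
    (p : unitInterval × unitInterval) : Set ℝ :=
  {r | ∀ c ∈ K, (c.1 p.1 < v p.1 → c.2 p.2 < r) ∧ (v p.1 < c.1 p.1 → r < c.2 p.2)}

lemma transferredValues_nonempty {K : Set (C(unitInterval, ℝ) × C(unitInterval, ℝ))}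
    (hK : K.Finite) {v : C(unitInterval, ℝ)} {p : unitInterval × unitInterval}
    (hp : ∀ c ∈ K, ∀ c' ∈ K, c.1 p.1 < c'.1 p.1 → c.2 p.2 < c'.2 p.2) :
    (transferredValues K v p).Nonempty := by
  classical
  obtain ⟨r, h1, h2⟩ := Order.exists_between_finsets
    ((hK.toFinset.filter fun c ↦ c.1 p.1 < v p.1).image fun c ↦ c.2 p.2)
    ((hK.toFinset.filter fun c ↦ v p.1 < c.1 p.1).image fun c ↦ c.2 p.2) (by
      simp only [Finset.mem_image, Finset.mem_filter, Set.Finite.mem_toFinset]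
      rintro _ ⟨c, ⟨hc, h1⟩, rfl⟩ _ ⟨c', ⟨hc', h2⟩, rfl⟩
      exact hp c hc c' hc' (h1.trans h2))
  simp only [Finset.mem_image, Finset.mem_filter, Set.Finite.mem_toFinset, forall_exists_index,
    and_imp] at h1 h2
  exact ⟨r, fun c hc ↦ ⟨fun h ↦ h1 _ c hc h rfl, fun h ↦ h2 _ c hc h rfl⟩⟩

/-- On `[p.2, q.2]`, the function `w` is placed with respect to the second components of the
curves in `K` as `v` is with respect to their first components on `[p.1, q.1]`. -/
structure Follows (K : Set (C(unitInterval, ℝ) × C(unitInterval, ℝ))) (v w : C(unitInterval, ℝ))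
    (p q : unitInterval × unitInterval) : Prop where
  left : w p.2 ∈ transferredValues K v p
  right : w q.2 ∈ transferredValues K v q
  lt : ∀ c ∈ K, (∀ x ∈ Set.Icc p.1 q.1, c.1 x < v x) → ∀ y ∈ Set.Icc p.2 q.2, c.2 y < w y
  gt : ∀ c ∈ K, (∀ x ∈ Set.Icc p.1 q.1, v x < c.1 x) → ∀ y ∈ Set.Icc p.2 q.2, w y < c.2 y
  exists_eq : ∀ c ∈ K, (∃ x ∈ Set.Icc p.1 q.1, v x = c.1 x) → ∃ y ∈ Set.Icc p.2 q.2, w y = c.2 y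

/-- An open region over the unit interval with nonempty convex fibres, unconstrained off
`[p.2, q.2]` and containing all of `E` over the endpoints, such that every continuous function
with graph in the region satisfies `F`. -/
def HasRegion (E : unitInterval × unitInterval → Set ℝ)
    (F : C(unitInterval, ℝ) → unitInterval × unitInterval → unitInterval × unitInterval → Prop)
    (p q : unitInterval × unitInterval) : Prop :=
  ∃ Z : Set (unitInterval × ℝ), IsOpen Z ∧ (∀ y, Convex ℝ {r | (y, r) ∈ Z}) ∧
    (∀ y, ∃ r, (y, r) ∈ Z) ∧ (∀ y ∉ Set.Icc p.2 q.2, ∀ r, (y, r) ∈ Z) ∧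
    (∀ r ∈ E p, (p.2, r) ∈ Z) ∧ (∀ r ∈ E q, (q.2, r) ∈ Z) ∧
    ∀ w : C(unitInterval, ℝ), (∀ y, (y, w y) ∈ Z) → F w p q

namespace HasRegion

variable {E : unitInterval × unitInterval → Set ℝ}
  {F : C(unitInterval, ℝ) → unitInterval × unitInterval → unitInterval × unitInterval → Prop}
  {p m q : unitInterval × unitInterval}

lemma mono {F' : C(unitInterval, ℝ) → unitInterval × unitInterval → unitInterval × unitInterval →
    Prop} (h : HasRegion E F p q) (hF : ∀ w, F w p q → F' w p q) : HasRegion E F' p q := by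
  obtain ⟨Z, h1, h2, h3, h4, h5, h6, h7⟩ := h
  exact ⟨Z, h1, h2, h3, h4, h5, h6, fun w hw ↦ hF w (h7 w hw)⟩

/-- Each region is free off its own interval, so the two constrain each other only over `m.2`, where
both contain the nonempty set `E m`. -/
lemma trans (hF : ∀ w, F w p m → F w m q → F w p q) (hpm : p.2 < m.2) (hmq : m.2 < q.2)
    (hE : (E m).Nonempty) (h₁ : HasRegion E F p m) (h₂ : HasRegion E F m q) :
    HasRegion E F p q := by
  obtain ⟨Z, hZo, hZc, hZn, hZout, hZp, hZm, hZF⟩ := h₁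
  obtain ⟨Y, hYo, hYc, hYn, hYout, hYm, hYq, hYF⟩ := h₂
  refine ⟨Z ∩ Y, hZo.inter hYo, fun y ↦ (hZc y).inter (hYc y), fun y ↦ ?_, fun y hy r ↦ ?_,
    fun r hr ↦ ⟨hZp r hr, ?_⟩, fun r hr ↦ ⟨?_, hYq r hr⟩,
    fun w hw ↦ hF w (hZF w fun y ↦ (hw y).1) (hYF w fun y ↦ (hw y).2)⟩
  · rcases lt_trichotomy y m.2 with h | rfl | h
    · obtain ⟨r, hr⟩ := hZn y
      exact ⟨r, hr, hYout y (fun hy ↦ h.not_ge hy.1) r⟩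
    · obtain ⟨r, hr⟩ := hE
      exact ⟨r, hZm r hr, hYm r hr⟩
    · obtain ⟨r, hr⟩ := hYn y
      exact ⟨r, hZout y (fun hy ↦ h.not_ge hy.2) r, hr⟩
  · exact ⟨hZout y (fun h ↦ hy ⟨h.1, h.2.trans hmq.le⟩) r,
      hYout y (fun h ↦ hy ⟨hpm.le.trans h.1, h.2⟩) r⟩
  · exact hYout _ (fun h ↦ hpm.not_ge h.1) r
  · exact hZout _ (fun h ↦ hmq.not_ge h.2) r

/-- Compactness of [0,1] gives openness. For nonemptiness, constants are locally admissible, and a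
partition of unity glues them because the fibres are convex. -/
lemma exists_isOpen (h : HasRegion E F p q) :
    ∃ U : Set C(unitInterval, ℝ), IsOpen U ∧ U.Nonempty ∧ ∀ w ∈ U, F w p q := by
  obtain ⟨Z, hZo, hZc, hZn, -, -, -, hZF⟩ := h
  refine ⟨{w | ∀ y, (y, w y) ∈ Z}, ?_, ?_, fun w hw ↦ hZF w hw⟩
  · have := (ContinuousMap.isOpen_setOfPred_mapsTo (isCompact_univ (X := unitInterval)) hZo).preimage
      (f := fun w : C(unitInterval, ℝ) ↦ (ContinuousMap.id unitInterval).prodMk w)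
      (ContinuousMap.continuous_of_continuous_uncurry _
        (continuous_snd.prodMk (continuous_fst.eval continuous_snd)))
    convert this using 1
    ext w
    simp [Set.MapsTo]
  · obtain ⟨w, hw⟩ := exists_continuous_forall_mem_convex_of_local_const hZc fun y ↦ by
      obtain ⟨r, hr⟩ := hZn y
      exact ⟨r, (Continuous.prodMk_left r).continuousAt.preimage_mem_nhds (hZo.mem_nhds hr)⟩
    exact ⟨w, hw⟩

end HasRegion

/-- Existence of a region forcing `w` to follow `v`. -/
lemma hasRegion_follows {K : Set (C(unitInterval, ℝ) × C(unitInterval, ℝ))} (hK : K.Finite)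
    {v : C(unitInterval, ℝ)} {p q : unitInterval × unitInterval} (hpq₁ : p.1 < q.1)
    (hpq₂ : p.2 < q.2)
    (hp : ∀ c ∈ K, ∀ c' ∈ K, c.1 p.1 < c'.1 p.1 → c.2 p.2 < c'.2 p.2)
    (hq : ∀ c ∈ K, ∀ c' ∈ K, c.1 q.1 < c'.1 q.1 → c.2 q.2 < c'.2 q.2)
    (hlt : ∀ c ∈ K, ∀ c' ∈ K, (∀ x ∈ Set.Icc p.1 q.1, c.1 x < c'.1 x) →
      ∀ y ∈ Set.Icc p.2 q.2, c.2 y < c'.2 y)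
    (huniq : ∀ c ∈ K, ∀ c' ∈ K, (∃ x ∈ Set.Icc p.1 q.1, v x = c.1 x) →
      (∃ x ∈ Set.Icc p.1 q.1, c'.1 x = c.1 x) → c' = c) :
    HasRegion (transferredValues K v) (Follows K v) p q := by
  obtain ⟨y₁, hpy, hyq⟩ := exists_between hpq₂
  obtain ⟨y₂, hyy, hyq₂⟩ := exists_between hyq
  have hpm : p.1 ∈ Set.Icc p.1 q.1 := Set.left_mem_Icc.2 hpq₁.le
  have hqm : q.1 ∈ Set.Icc p.1 q.1 := Set.right_mem_Icc.2 hpq₁.le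
  -- Curves missed by `v` bound `w` on the whole interval, and endpoint comparisons are copied. A
  -- curve met by `v` must lie below `w` at `y₁` and above it at `y₂ > y₁`, which forces a meeting.
  -- Each curve is active on a closed set, so the region is open.
  set Lo : unitInterval → C(unitInterval, ℝ) × C(unitInterval, ℝ) → Prop := fun y c ↦
    (y ∈ Set.Icc p.2 q.2 ∧ ∀ x ∈ Set.Icc p.1 q.1, c.1 x < v x) ∨ (y = p.2 ∧ c.1 p.1 < v p.1) ∨
      (y = q.2 ∧ c.1 q.1 < v q.1) ∨ (y = y₁ ∧ ∃ x ∈ Set.Icc p.1 q.1, v x = c.1 x) with hLo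
  set Up : unitInterval → C(unitInterval, ℝ) × C(unitInterval, ℝ) → Prop := fun y c ↦
    (y ∈ Set.Icc p.2 q.2 ∧ ∀ x ∈ Set.Icc p.1 q.1, v x < c.1 x) ∨ (y = p.2 ∧ v p.1 < c.1 p.1) ∨
      (y = q.2 ∧ v q.1 < c.1 q.1) ∨ (y = y₂ ∧ ∃ x ∈ Set.Icc p.1 q.1, v x = c.1 x) with hUp
  have hclosed (J : Set unitInterval) (hJ : IsClosed J) (P P₁ P₂ P₃ : Prop)
      (a b c : unitInterval) :
      IsClosed {y | (y ∈ J ∧ P) ∨ (y = a ∧ P₁) ∨ (y = b ∧ P₂) ∨ (y = c ∧ P₃)} :=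
    (hJ.and isClosed_const).union <| (isClosed_singleton.and isClosed_const).union <|
      (isClosed_singleton.and isClosed_const).union (isClosed_singleton.and isClosed_const)
  have hLoc (c) : IsClosed {y | Lo y c} := hclosed _ isClosed_Icc _ _ _ _ _ _ _
  have hUpc (c) : IsClosed {y | Up y c} := hclosed _ isClosed_Icc _ _ _ _ _ _ _
  have hmem {y c} (h : Lo y c ∨ Up y c) : y ∈ Set.Icc p.2 q.2 := by
    simp only [hLo, hUp] at h
    grind
  have hLoUp : ∀ c ∈ K, ∀ c' ∈ K, ∀ y, Lo y c → Up y c' → c.2 y < c'.2 y := by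
    intro c hc c' hc' y h h'
    have hy := hmem (.inl h)
    by_cases hyp : y = p.2
    · subst hyp
      have h1 : c.1 p.1 < v p.1 := by
        rcases h with h | h | h | h
        · exact h.2 _ hpm
        · exact h.2
        · exact absurd h.1 hpq₂.ne
        · exact absurd h.1 hpy.ne
      have h2 : v p.1 < c'.1 p.1 := by
        rcases h' with h | h | h | h
        · exact h.2 _ hpm
        · exact h.2
        · exact absurd h.1 hpq₂.ne
        · exact absurd h.1 (hpy.trans hyy).ne
      exact hp c hc c' hc' (h1.trans h2)
    by_cases hyq' : y = q.2
    · subst hyq'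
      have h1 : c.1 q.1 < v q.1 := by
        rcases h with h | h | h | h
        · exact h.2 _ hqm
        · exact absurd h.1 hpq₂.ne'
        · exact h.2
        · exact absurd h.1 hyq.ne'
      have h2 : v q.1 < c'.1 q.1 := by
        rcases h' with h | h | h | h
        · exact h.2 _ hqm
        · exact absurd h.1 hpq₂.ne'
        · exact h.2
        · exact absurd h.1 hyq₂.ne'
      exact hq c hc c' hc' (h1.trans h2)
    -- A curve met by `v` which is below (above) another one at that point stays so throughout.
    have hcross {c c' : C(unitInterval, ℝ) × C(unitInterval, ℝ)}
        (hx : (∃ x ∈ Set.Icc p.1 q.1, v x = c.1 x)) (hc : c ∈ K) (hc' : c' ∈ K)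
        (hne : ∀ x ∈ Set.Icc p.1 q.1, v x ≠ c'.1 x) :
        ∀ x ∈ Set.Icc p.1 q.1, (c'.1 - c.1) x ≠ 0 := by
      intro x hxm h0
      obtain rfl := huniq c hc c' hc' hx ⟨x, hxm, sub_eq_zero.1 h0⟩
      obtain ⟨z, hz, hvz⟩ := hx
      exact hne z hz hvz
    rcases h with h | h | h | h
    · rcases h' with h' | h' | h' | h'
      · exact hlt c hc c' hc' (fun x hx ↦ (h.2 x hx).trans (h'.2 x hx)) y hy
      · exact absurd h'.1 hyp
      · exact absurd h'.1 hyq'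
      · refine hlt c hc c' hc' (fun x hx ↦ ?_) y hy
        have hne := hcross h'.2 hc' hc fun x hx ↦ (h.2 x hx).ne'
        obtain ⟨z, hz, hvz⟩ := h'.2
        have hzlt := h.2 z hz
        by_contra hle
        have hxpos : 0 < (c.1 - c'.1) x := lt_of_le_of_ne (sub_nonneg.2 (not_lt.1 hle))
          (hne x hx).symm
        have := (pos_iff_of_forall_ne_zero hne hx hz).1 hxpos
        simp only [ContinuousMap.sub_apply] at this
        linarith
    · exact absurd h.1 hyp
    · exact absurd h.1 hyq'
    · rcases h' with h' | h' | h' | h'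
      · refine hlt c hc c' hc' (fun x hx ↦ ?_) y hy
        have hne := hcross h.2 hc hc' fun x hx ↦ (h'.2 x hx).ne
        obtain ⟨z, hz, hvz⟩ := h.2
        have hzlt := h'.2 z hz
        have hzpos : 0 < (c'.1 - c.1) z := by
          simp only [ContinuousMap.sub_apply]
          linarith
        exact sub_pos.1 ((pos_iff_of_forall_ne_zero hne hz hx).1 hzpos)
      · exact absurd h'.1 hyp
      · exact absurd h'.1 hyq'
      · exact absurd (h.1.symm.trans h'.1) hyy.ne
  refine ⟨{z | ∀ c ∈ K, (Lo z.1 c → c.2 z.1 < z.2) ∧ (Up z.1 c → z.2 < c.2 z.1)}, ?_, fun y ↦ ?_,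
    fun y ↦ ?_, fun y hy r c hc ↦ ⟨fun h ↦ absurd (hmem (.inl h)) hy,
      fun h ↦ absurd (hmem (.inr h)) hy⟩, fun r hr c hc ↦ ⟨fun h ↦ ?_, fun h ↦ ?_⟩,
    fun r hr c hc ↦ ⟨fun h ↦ ?_, fun h ↦ ?_⟩, fun w hw ↦ ?_⟩
  · have : {z : unitInterval × ℝ | ∀ c ∈ K, (Lo z.1 c → c.2 z.1 < z.2) ∧ (Up z.1 c → z.2 < c.2 z.1)}
        = ⋂ c ∈ K, ({z | ¬ Lo z.1 c} ∪ {z | c.2 z.1 < z.2}) ∩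
          ({z | ¬ Up z.1 c} ∪ {z | z.2 < c.2 z.1}) := by
      ext z
      simp only [Set.mem_ofPred_eq, Set.mem_iInter, Set.mem_inter_iff, Set.mem_union,
        imp_iff_not_or]
    rw [this]
    refine hK.isOpen_biInter fun c _ ↦ ((IsOpen.union ?_ ?_).inter (IsOpen.union ?_ ?_))
    · exact (hLoc c).isOpen_compl.preimage continuous_fst
    · exact isOpen_lt (by fun_prop) (by fun_prop)
    · exact (hUpc c).isOpen_compl.preimage continuous_fst
    · exact isOpen_lt (by fun_prop) (by fun_prop)
  · have : {r : ℝ | ∀ c ∈ K, (Lo y c → c.2 y < r) ∧ (Up y c → r < c.2 y)} =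
        (⋂ c ∈ {c ∈ K | Lo y c}, Set.Ioi (c.2 y)) ∩ ⋂ c ∈ {c ∈ K | Up y c}, Set.Iio (c.2 y) := by
      ext r
      simp only [Set.mem_ofPred_eq, Set.mem_iInter, Set.mem_inter_iff, Set.mem_Ioi, Set.mem_Iio]
      grind
    refine this ▸ Convex.inter ?_ ?_
    · exact convex_iInter fun c ↦ convex_iInter fun _ ↦ convex_Ioi _
    · exact convex_iInter fun c ↦ convex_iInter fun _ ↦ convex_Iio _
  · classical
    obtain ⟨r, h1, h2⟩ := Order.exists_between_finsets
      ((hK.toFinset.filter fun c ↦ Lo y c).image fun c ↦ c.2 y)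
      ((hK.toFinset.filter fun c ↦ Up y c).image fun c ↦ c.2 y) (by
        simp only [Finset.mem_image, Finset.mem_filter, Set.Finite.mem_toFinset]
        rintro _ ⟨c, ⟨hc, h1⟩, rfl⟩ _ ⟨c', ⟨hc', h2⟩, rfl⟩
        exact hLoUp c hc c' hc' y h1 h2)
    simp only [Finset.mem_image, Finset.mem_filter, Set.Finite.mem_toFinset, forall_exists_index,
      and_imp] at h1 h2
    exact ⟨r, fun c hc ↦ ⟨fun h ↦ h1 _ c hc h rfl, fun h ↦ h2 _ c hc h rfl⟩⟩
  · refine (hr c hc).1 ?_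
    rcases h with h | h | h | h
    · exact h.2 _ hpm
    · exact h.2
    · exact absurd h.1 hpq₂.ne
    · exact absurd h.1 hpy.ne
  · refine (hr c hc).2 ?_
    rcases h with h | h | h | h
    · exact h.2 _ hpm
    · exact h.2
    · exact absurd h.1 hpq₂.ne
    · exact absurd h.1 (hpy.trans hyy).ne
  · refine (hr c hc).1 ?_
    rcases h with h | h | h | h
    · exact h.2 _ hqm
    · exact absurd h.1 hpq₂.ne'
    · exact h.2
    · exact absurd h.1 hyq.ne'
  · refine (hr c hc).2 ?_
    rcases h with h | h | h | h
    · exact h.2 _ hqm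
    · exact absurd h.1 hpq₂.ne'
    · exact h.2
    · exact absurd h.1 hyq₂.ne'
  · refine ⟨fun c hc ↦ ⟨fun h ↦ (hw _ c hc).1 (.inr (.inl ⟨rfl, h⟩)),
        fun h ↦ (hw _ c hc).2 (.inr (.inl ⟨rfl, h⟩))⟩,
      fun c hc ↦ ⟨fun h ↦ (hw _ c hc).1 (.inr (.inr (.inl ⟨rfl, h⟩))),
        fun h ↦ (hw _ c hc).2 (.inr (.inr (.inl ⟨rfl, h⟩)))⟩,
      fun c hc h y hy ↦ (hw y c hc).1 (.inl ⟨hy, h⟩), fun c hc h y hy ↦ (hw y c hc).2 (.inl ⟨hy, h⟩),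
      fun c hc h ↦ ?_⟩
    have h1 : c.2 y₁ < w y₁ := (hw y₁ c hc).1 (.inr (.inr (.inr ⟨rfl, h⟩)))
    have h2 : w y₂ < c.2 y₂ := (hw y₂ c hc).2 (.inr (.inr (.inr ⟨rfl, h⟩)))
    obtain ⟨z, hz, hz0⟩ := exists_zero_of_pos_iff hyy.le (d := w - c.2) (by
      simp only [ContinuousMap.sub_apply, sub_pos]
      exact fun h ↦ h2.not_gt (h.1 h1))
    exact ⟨z, ⟨hpy.le.trans hz.1, hz.2.trans hyq₂.le⟩, sub_eq_zero.1 hz0⟩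

/-! ### Extending a matched chain by one function -/

/-- The differences, shifted by integers, of distinct elements of a set of pairs of functions. -/
def shiftedDifferences (A : Set (C(unitInterval, ℝ) × C(unitInterval, ℝ))) :
    Set (C(unitInterval, ℝ) × C(unitInterval, ℝ)) :=
  {e | ∃ a ∈ A, ∃ b ∈ A, a ≠ b ∧ ∃ k : ℤ,
    e = a - b - (k : C(unitInterval, ℝ) × C(unitInterval, ℝ))}

/-- Shifts by the integers of absolute value at most `N` of the elements of `A`. -/
def boundedShifts (A : Set (C(unitInterval, ℝ) × C(unitInterval, ℝ))) (N : ℕ) :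
    Set (C(unitInterval, ℝ) × C(unitInterval, ℝ)) :=
  {c | ∃ a ∈ A, ∃ k : ℤ, |k| ≤ N ∧ c = a + (k : C(unitInterval, ℝ) × C(unitInterval, ℝ))}

/-- A finite partial bijection from `V` to `W`. -/
structure IsFinitePartialBij (V W : Set C(unitInterval, ℝ))
    (A : Set (C(unitInterval, ℝ) × C(unitInterval, ℝ))) : Prop where
  finite : A.Finite
  subset : A ⊆ V ×ˢ W
  fst_eq_iff : ∀ a ∈ A, ∀ b ∈ A, (a.1 = b.1 ↔ a.2 = b.2)

section

variable {V W : Set C(unitInterval, ℝ)} {A : Set (C(unitInterval, ℝ) × C(unitInterval, ℝ))}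
  {v w : C(unitInterval, ℝ)} {p q : unitInterval × unitInterval} {N : ℕ}

lemma Set.Finite.boundedShifts (hA : A.Finite) (N : ℕ) : (boundedShifts A N).Finite := by
  refine ((hA.prod (Set.finite_Icc (-(N : ℤ)) N)).image fun x ↦
    x.1 + (x.2 : C(unitInterval, ℝ) × C(unitInterval, ℝ))).subset ?_
  rintro _ ⟨a, ha, k, hk, rfl⟩
  exact ⟨(a, k), ⟨ha, abs_le.1 hk⟩, rfl⟩

namespace IsFinitePartialBij

lemma ext_fst (hA : IsFinitePartialBij V W A) {a b : C(unitInterval, ℝ) × C(unitInterval, ℝ)}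
    (ha : a ∈ A) (hb : b ∈ A) (h : a.1 = b.1) : a = b :=
  Prod.ext h ((hA.fst_eq_iff a ha b hb).1 h)

lemma ext_snd (hA : IsFinitePartialBij V W A) {a b : C(unitInterval, ℝ) × C(unitInterval, ℝ)}
    (ha : a ∈ A) (hb : b ∈ A) (h : a.2 = b.2) : a = b :=
  Prod.ext ((hA.fst_eq_iff a ha b hb).2 h) h

lemma fst_apply_ne_zero (hA : IsFinitePartialBij V W A)
    {e : C(unitInterval, ℝ) × C(unitInterval, ℝ)} (he : e ∈ shiftedDifferences A)
    {x : unitInterval} (hx : x ∈ regularPoints V) : e.1 x ≠ 0 := by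
  obtain ⟨a, ha, b, hb, hab, k, rfl⟩ := he
  have := sub_ne_of_mem_regularPoints hx (hA.subset ha).1 (hA.subset hb).1
    (fun h ↦ hab (hA.ext_fst ha hb h)) k
  simpa [sub_eq_zero] using this

lemma snd_apply_ne_zero (hA : IsFinitePartialBij V W A)
    {e : C(unitInterval, ℝ) × C(unitInterval, ℝ)} (he : e ∈ shiftedDifferences A)
    {x : unitInterval} (hx : x ∈ regularPoints W) : e.2 x ≠ 0 := by
  obtain ⟨a, ha, b, hb, hab, k, rfl⟩ := he
  have := sub_ne_of_mem_regularPoints hx (hA.subset ha).2 (hA.subset hb).2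
    (fun h ↦ hab (hA.ext_snd ha hb h)) k
  simpa [sub_eq_zero] using this

lemma oscillates_snd (hW : IsICDense W) (hA : IsFinitePartialBij V W A)
    {e : C(unitInterval, ℝ) × C(unitInterval, ℝ)} (he : e ∈ shiftedDifferences A) :
    Oscillates e.2 := by
  obtain ⟨a, ha, b, hb, hab, k, rfl⟩ := he
  exact hW.oscillates (hA.subset ha).2 (hA.subset hb).2 (fun h ↦ hab (hA.ext_snd ha hb h)) k

end IsFinitePartialBij

/-- Shifts of one function are ordered by their integers; for different functions, `c' - c` is
itself a shifted difference. -/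
lemma lt_of_lt_of_mem_boundedShifts {x y : unitInterval}
    (hsign : ∀ e ∈ shiftedDifferences A, 0 < e.1 x → 0 < e.2 y)
    {c c' : C(unitInterval, ℝ) × C(unitInterval, ℝ)} (hc : c ∈ boundedShifts A N)
    (hc' : c' ∈ boundedShifts A N) (h : c.1 x < c'.1 x) : c.2 y < c'.2 y := by
  obtain ⟨a, ha, k, -, rfl⟩ := hc
  obtain ⟨b, hb, m, -, rfl⟩ := hc'
  by_cases hab : b = a
  · subst hab
    simpa using h
  · have := hsign _ ⟨b, hb, a, ha, hab, k - m, rfl⟩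
    simp at this h ⊢
    have := this (by linarith)
    linarith

lemma forall_lt_of_mem_boundedShifts {J J' : Set unitInterval} (hJ : J.Nonempty)
    (hpos : ∀ e ∈ shiftedDifferences A, (∀ x ∈ J, 0 < e.1 x) → ∀ y ∈ J', 0 < e.2 y)
    {c c' : C(unitInterval, ℝ) × C(unitInterval, ℝ)} (hc : c ∈ boundedShifts A N)
    (hc' : c' ∈ boundedShifts A N) (h : ∀ x ∈ J, c.1 x < c'.1 x) : ∀ y ∈ J', c.2 y < c'.2 y := by
  obtain ⟨a, ha, k, -, rfl⟩ := hc
  obtain ⟨b, hb, m, -, rfl⟩ := hc'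
  intro y hy
  by_cases hab : b = a
  · subst hab
    obtain ⟨x, hx⟩ := hJ
    simpa using h x hx
  · have := hpos _ ⟨b, hb, a, ha, hab, k - m, rfl⟩ (fun x hx ↦ by
      have := h x hx
      simp at this ⊢
      linarith) y hy
    simp at this ⊢
    linarith

/-- If `v` meets a shift of `a` and a shift of `b ≠ a` meets that same shift, the interval carries
crossings of two different pairs, against `UniqueCrossing`. -/
lemma Matched.hasRegion_follows (hA : IsFinitePartialBij V W A)
    (hv : ∀ a ∈ A, a.1 ≠ v)
    (h : Matched (shiftedDifferences A) (regularPoints V) (regularPoints W) p q)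
    (hu : UniqueCrossing (insert v (Prod.fst '' A)) p.1 q.1) :
    HasRegion (transferredValues (boundedShifts A N) v) (Follows (boundedShifts A N) v) p q := by
  refine _root_.hasRegion_follows (hA.finite.boundedShifts N) h.fst_lt h.snd_lt
    (fun c hc c' hc' ↦ lt_of_lt_of_mem_boundedShifts (fun e he ↦ (h.sign_left e he).1) hc hc')
    (fun c hc c' hc' ↦ lt_of_lt_of_mem_boundedShifts (fun e he ↦ (h.sign_right e he).1) hc hc')
    (fun c hc c' hc' ↦ forall_lt_of_mem_boundedShifts ⟨_, Set.left_mem_Icc.2 h.fst_lt.le⟩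
      (fun e he ↦ h.forall_pos he) hc hc') ?_
  rintro _ ⟨a, ha, k, -, rfl⟩ _ ⟨b, hb, m, -, rfl⟩ ⟨x, hx, hvx⟩ ⟨y, hy, hby⟩
  simp only [Prod.fst_add, Prod.fst_intCast, ContinuousMap.add_apply,
    ContinuousMap.intCast_apply] at hvx hby
  by_cases hab : b = a
  · subst hab
    have : m = k := by exact_mod_cast add_left_cancel hby
    rw [this]
  · rcases hu v (.inl rfl) a.1 (.inr ⟨a, ha, rfl⟩) b.1 (.inr ⟨b, hb, rfl⟩) a.1
      (.inr ⟨a, ha, rfl⟩) (hv a ha).symm (fun h ↦ hab (hA.ext_fst hb ha h)) k (k - m) x hx y hy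
      (by linarith) (by push_cast; linarith) with ⟨h1, -, -⟩ | ⟨-, h1, -⟩
    · exact absurd h1 (hv b hb)
    · exact absurd h1 (hv a ha)

/-- The position of `w` relative to a shifted curve agrees with that of `v`. -/
lemma Follows.compare (h : Follows (boundedShifts A N) v w p q) (hpq₁ : p.1 < q.1)
    (hpq₂ : p.2 < q.2) {a : C(unitInterval, ℝ) × C(unitInterval, ℝ)} (ha : a ∈ A)
    (hN : ∀ x, |v x - a.1 x| < N) (k : ℤ) (hp : v p.1 - a.1 p.1 ≠ k) (hq : v q.1 - a.1 q.1 ≠ k) :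
    ((k < v p.1 - a.1 p.1 ↔ k < w p.2 - a.2 p.2) ∧ (v p.1 - a.1 p.1 < k ↔ w p.2 - a.2 p.2 < k)) ∧
    ((k < v q.1 - a.1 q.1 ↔ k < w q.2 - a.2 q.2) ∧ (v q.1 - a.1 q.1 < k ↔ w q.2 - a.2 q.2 < k)) ∧
    ((∃ x ∈ Set.Icc p.1 q.1, v x - a.1 x = k) ↔ ∃ y ∈ Set.Icc p.2 q.2, w y - a.2 y = k) := by
  have hpm := Set.left_mem_Icc.2 hpq₁.le
  have hqm := Set.right_mem_Icc.2 hpq₁.le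
  have hpm' := Set.left_mem_Icc.2 hpq₂.le
  have hqm' := Set.right_mem_Icc.2 hpq₂.le
  have hlt (k : ℤ) (hk : |k| ≤ N) (hx : ∀ x ∈ Set.Icc p.1 q.1, k < v x - a.1 x) :
      ∀ y ∈ Set.Icc p.2 q.2, k < w y - a.2 y := by
    intro y hy
    have := h.lt _ ⟨a, ha, k, hk, rfl⟩ (fun x hxm ↦ by
      have := hx x hxm
      simp
      linarith) y hy
    simp at this
    linarith
  have hgt (k : ℤ) (hk : |k| ≤ N) (hx : ∀ x ∈ Set.Icc p.1 q.1, v x - a.1 x < k) :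
      ∀ y ∈ Set.Icc p.2 q.2, w y - a.2 y < k := by
    intro y hy
    have := h.gt _ ⟨a, ha, k, hk, rfl⟩ (fun x hxm ↦ by
      have := hx x hxm
      simp
      linarith) y hy
    simp at this
    linarith
  have hconst : ((∀ x ∈ Set.Icc p.1 q.1, k < v x - a.1 x) ∧
        ∀ y ∈ Set.Icc p.2 q.2, k < w y - a.2 y) ∨
      ((∀ x ∈ Set.Icc p.1 q.1, v x - a.1 x < k) ∧
        ∀ y ∈ Set.Icc p.2 q.2, w y - a.2 y < k) ∨
      (|k| ≤ N ∧ ∃ x ∈ Set.Icc p.1 q.1, v x - a.1 x = k) := by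
    by_cases hk : |k| ≤ N
    · by_cases hex : ∃ x ∈ Set.Icc p.1 q.1, v x - a.1 x = k
      · exact .inr (.inr ⟨hk, hex⟩)
      push Not at hex
      have hne : ∀ x ∈ Set.Icc p.1 q.1,
          (v - a.1 - ((k : ℤ) : C(unitInterval, ℝ))) x ≠ 0 := by
        intro x hx
        simpa [sub_eq_zero] using hex x hx
      by_cases hpos : k < v p.1 - a.1 p.1
      · have : ∀ x ∈ Set.Icc p.1 q.1, k < v x - a.1 x := by
          intro x hx
          simpa using (pos_iff_of_forall_ne_zero hne hpm hx).1 (by simpa using hpos)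
        exact .inl ⟨this, hlt k hk this⟩
      · have : ∀ x ∈ Set.Icc p.1 q.1, v x - a.1 x < k := by
          intro x hx
          refine lt_of_le_of_ne (not_lt.1 fun hlt ↦ hpos ?_) (hex x hx)
          simpa using (pos_iff_of_forall_ne_zero hne hx hpm).1 (by simpa using hlt)
        exact .inr (.inl ⟨this, hgt k hk this⟩)
    · rcases lt_abs.1 (not_le.1 hk) with hk | hk
      · have hk' : (N : ℝ) < k := by exact_mod_cast hk
        refine .inr (.inl ⟨fun x _ ↦ (abs_lt.1 (hN x)).2.trans hk', fun y hy ↦ ?_⟩)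
        have := hgt N (by simp) (fun x _ ↦ by simpa using (abs_lt.1 (hN x)).2) y hy
        push_cast at this
        linarith
      · have hk' : (k : ℝ) < -N := by
          have : k < -(N : ℤ) := by linarith
          exact_mod_cast this
        refine .inl ⟨fun x _ ↦ hk'.trans (abs_lt.1 (hN x)).1, fun y hy ↦ ?_⟩
        have := hlt (-N) (by simp) (fun x _ ↦ by simpa using (abs_lt.1 (hN x)).1) y hy
        push_cast at this
        linarith
  rcases hconst with ⟨h1, h2⟩ | ⟨h1, h2⟩ | ⟨hk, hex⟩
  · refine ⟨⟨iff_of_true (h1 _ hpm) (h2 _ hpm'), iff_of_false (h1 _ hpm).not_gt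
      (h2 _ hpm').not_gt⟩, ⟨iff_of_true (h1 _ hqm) (h2 _ hqm'), iff_of_false (h1 _ hqm).not_gt
      (h2 _ hqm').not_gt⟩, iff_of_false ?_ ?_⟩
    · exact fun ⟨x, hx, h⟩ ↦ (h1 x hx).ne' h
    · exact fun ⟨x, hx, h⟩ ↦ (h2 x hx).ne' h
  · refine ⟨⟨iff_of_false (h1 _ hpm).not_gt (h2 _ hpm').not_gt, iff_of_true (h1 _ hpm)
      (h2 _ hpm')⟩, ⟨iff_of_false (h1 _ hqm).not_gt (h2 _ hqm').not_gt, iff_of_true (h1 _ hqm)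
      (h2 _ hqm')⟩, iff_of_false ?_ ?_⟩
    · exact fun ⟨x, hx, h⟩ ↦ (h1 x hx).ne h
    · exact fun ⟨x, hx, h⟩ ↦ (h2 x hx).ne h
  · have hval {z : unitInterval × unitInterval} (hz : v z.1 - a.1 z.1 ≠ k)
        (hw : w z.2 ∈ transferredValues (boundedShifts A N) v z) :
        (k < v z.1 - a.1 z.1 ↔ k < w z.2 - a.2 z.2) ∧
          (v z.1 - a.1 z.1 < k ↔ w z.2 - a.2 z.2 < k) := by
      have := hw _ ⟨a, ha, k, hk, rfl⟩
      simp only [Prod.fst_add, Prod.snd_add, Prod.fst_intCast, Prod.snd_intCast,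
        ContinuousMap.add_apply, ContinuousMap.intCast_apply] at this
      rcases lt_or_gt_of_ne hz with hlt | hlt
      · have := this.2 (by linarith)
        constructor <;> constructor <;> intro <;> linarith
      · have := this.1 (by linarith)
        constructor <;> constructor <;> intro <;> linarith
    refine ⟨hval hp h.left, hval hq h.right, iff_of_true hex ?_⟩
    obtain ⟨x, hx, hvx⟩ := hex
    obtain ⟨y, hy, hwy⟩ := h.exists_eq _ ⟨a, ha, k, hk, rfl⟩ ⟨x, hx, by simp; linarith⟩
    refine ⟨y, hy, ?_⟩
    simp at hwy
    linarith

/-- Differences involving `v` are controlled by `Follows.compare`, the old ones by `h`. The two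
alternatives of `UniqueCrossing` are exactly equality and negation of shifted differences. -/
lemma Matched.insert (hA : IsFinitePartialBij V W A) (hvV : v ∈ V) (hv : ∀ a ∈ A, a.1 ≠ v)
    (h : Matched (shiftedDifferences A) (regularPoints V) (regularPoints W) p q)
    (hu : UniqueCrossing (insert v (Prod.fst '' A)) p.1 q.1)
    (hN : ∀ a ∈ A, ∀ x, |v x - a.1 x| < N) (hw : Follows (boundedShifts A N) v w p q) :
    Matched (shiftedDifferences (insert (v, w) A)) (regularPoints V) (regularPoints W) p q := by
  have hcmp {a} (ha : a ∈ A) (k : ℤ) := hw.compare h.fst_lt h.snd_lt ha (hN a ha) k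
    (sub_ne_of_mem_regularPoints h.left_mem.1 hvV (hA.subset ha).1 (hv a ha).symm k)
    (sub_ne_of_mem_regularPoints h.right_mem.1 hvV (hA.subset ha).1 (hv a ha).symm k)
  have hall : ∀ e ∈ shiftedDifferences (Insert.insert (v, w) A), (0 < e.1 p.1 ↔ 0 < e.2 p.2) ∧
      (0 < e.1 q.1 ↔ 0 < e.2 q.2) ∧
      ((∃ x ∈ Set.Icc p.1 q.1, e.1 x = 0) ↔ ∃ y ∈ Set.Icc p.2 q.2, e.2 y = 0) := by
    rintro _ ⟨a, rfl | ha, b, rfl | hb, hab, k, rfl⟩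
    · exact absurd rfl hab
    · obtain ⟨h1, h2, h3⟩ := hcmp hb k
      simp only [Prod.fst_sub, Prod.snd_sub, Prod.fst_intCast, Prod.snd_intCast,
        ContinuousMap.sub_apply, ContinuousMap.intCast_apply, sub_pos, sub_eq_zero (b := (k : ℝ))]
      exact ⟨h1.1, h2.1, h3⟩
    -- Reversing the pair turns level `k` into level `-k` and exchanges the two strict inequalities.
    · obtain ⟨h1, h2, h3⟩ := hcmp ha (-k)
      have flip (s t : ℝ) : (0 < s - t - k ↔ t - s < (-k : ℤ)) ∧ (s - t - k = 0 ↔ t - s = (-k : ℤ)) := by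
        push_cast
        constructor <;> constructor <;> intro <;> linarith
      simp only [Prod.fst_sub, Prod.snd_sub, Prod.fst_intCast, Prod.snd_intCast,
        ContinuousMap.sub_apply, ContinuousMap.intCast_apply, flip]
      exact ⟨h1.2, h2.2, h3⟩
    · have he : a - b - (k : C(unitInterval, ℝ) × C(unitInterval, ℝ)) ∈ shiftedDifferences A :=
        ⟨a, ha, b, hb, hab, k, rfl⟩
      exact ⟨h.sign_left _ he, h.sign_right _ he, h.exists_zero_iff _ he⟩
  have hext {a b} (ha : a ∈ Insert.insert (v, w) A) (hb : b ∈ Insert.insert (v, w) A)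
      (hab : a.1 = b.1) : a = b := by
    rcases ha with rfl | ha <;> rcases hb with rfl | hb
    · rfl
    · exact absurd hab.symm (hv b hb)
    · exact absurd hab (hv a ha)
    · exact hA.ext_fst ha hb hab
  have hmem {a} (ha : a ∈ Insert.insert (v, w) A) : a.1 ∈ Insert.insert v (Prod.fst '' A) := by
    rcases ha with rfl | ha
    · exact .inl rfl
    · exact .inr ⟨a, ha, rfl⟩
  exact
    { fst_lt := h.fst_lt
      snd_lt := h.snd_lt
      left_mem := h.left_mem
      right_mem := h.right_mem
      sign_left := fun e he ↦ (hall e he).1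
      sign_right := fun e he ↦ (hall e he).2.1
      exists_zero_iff := fun e he ↦ (hall e he).2.2
      eq_or_eq_neg := by
        rintro _ ⟨a, ha, b, hb, hab, k, rfl⟩ _ ⟨a', ha', b', hb', hab', m, rfl⟩ ⟨x, hx, hx0⟩
          ⟨y, hy, hy0⟩
        rcases hu a.1 (hmem ha) b.1 (hmem hb) a'.1 (hmem ha') b'.1 (hmem hb')
          (fun h ↦ hab (hext ha hb h)) (fun h ↦ hab' (hext ha' hb' h)) k m x hx y hy
          (by simpa [sub_eq_zero] using hx0) (by simpa [sub_eq_zero] using hy0) with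
          ⟨h1, h2, rfl⟩ | ⟨h1, h2, rfl⟩
        · rw [hext ha' ha h1, hext hb' hb h2]
          exact .inl rfl
        · rw [hext ha' hb h1, hext hb' ha h2]
          right
          push_cast
          abel }

lemma Matched.snd_lt_of_transGen {Δ : Set (C(unitInterval, ℝ) × C(unitInterval, ℝ))}
    {D D' : Set unitInterval} {Q : unitInterval × unitInterval → unitInterval × unitInterval → Prop}
    (h : Relation.TransGen (fun p q ↦ Matched Δ D D' p q ∧ Q p q) p q) : p.2 < q.2 :=
  Relation.TransGen.trans_induction_on h (fun h ↦ h.1.snd_lt) fun _ _ h1 h2 ↦ h1.trans h2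

lemma Matched.forall_pos_of_transGen {Δ : Set (C(unitInterval, ℝ) × C(unitInterval, ℝ))}
    {D D' : Set unitInterval} (h : Relation.TransGen (Matched Δ D D') p q)
    {e : C(unitInterval, ℝ) × C(unitInterval, ℝ)} (he : e ∈ Δ)
    (hpos : ∀ x ∈ Set.Icc p.1 q.1, 0 < e.1 x) : ∀ y ∈ Set.Icc p.2 q.2, 0 < e.2 y := by
  have key : p.1 < q.1 ∧ ((∀ x ∈ Set.Icc p.1 q.1, 0 < e.1 x) →
      ∀ y ∈ Set.Icc p.2 q.2, 0 < e.2 y) := by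
    clear hpos
    induction h using Relation.TransGen.trans_induction_on with
    | single h => exact ⟨h.fst_lt, h.forall_pos he⟩
    | @trans p m q _ _ h1 h2 =>
      refine ⟨h1.1.trans h2.1, fun hx y hy ↦ ?_⟩
      rcases le_total y m.2 with hym | hym
      · exact h1.2 (fun x hx' ↦ hx x ⟨hx'.1, hx'.2.trans h2.1.le⟩) y ⟨hy.1, hym⟩
      · exact h2.2 (fun x hx' ↦ hx x ⟨h1.1.le.trans hx'.1, hx'.2⟩) y ⟨hym, hy.2⟩
  exact key.2 hpos

/-- A matched chain of intervals can be extended by a new function `v ∈ V` and any function `w`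
in a suitable nonempty open set. -/
theorem exists_isOpen_forall_transGen_matched (hV : IsICDense V) (hW : IsICDense W)
    (hA : IsFinitePartialBij V W A) (hvV : v ∈ V) (hv : ∀ a ∈ A, a.1 ≠ v)
    (h : Relation.TransGen
      (Matched (shiftedDifferences A) (regularPoints V) (regularPoints W)) p q) :
    ∃ U : Set C(unitInterval, ℝ), IsOpen U ∧ U.Nonempty ∧ ∀ w ∈ U, Relation.TransGen
      (Matched (shiftedDifferences (insert (v, w) A)) (regularPoints V) (regularPoints W)) p q := by
  obtain ⟨N, hN⟩ : ∃ N : ℕ, ∀ a ∈ A, ∀ x, |v x - a.1 x| < N := by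
    obtain ⟨B, hB⟩ := (hA.finite.image fun a ↦ ‖v - a.1‖).bddAbove
    obtain ⟨N, hN⟩ := exists_nat_gt B
    exact ⟨N, fun a ha x ↦ (((v - a.1).norm_coe_le_norm x).trans (hB ⟨a, ha, rfl⟩)).trans_lt hN⟩
  have hS : insert v (Prod.fst '' A) ⊆ V := by
    rintro _ (rfl | ⟨a, ha, rfl⟩)
    · exact hvV
    · exact (hA.subset ha).1
  -- Each link is refined on the `V` side, and the cuts are copied to the `W` side by the
  -- oscillation of `W`.
  have href : Relation.TransGen (fun p q ↦
      Matched (shiftedDifferences A) (regularPoints V) (regularPoints W) p q ∧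
        UniqueCrossing (insert v (Prod.fst '' A)) p.1 q.1) p q := by
    refine Relation.TransGen.closed (fun p q hpq ↦ ?_) _ _ h
    exact hpq.transGen_of_transGen hW.dense_regularPoints (fun e he x ↦ hA.fst_apply_ne_zero he)
      (fun e he x ↦ hA.snd_apply_ne_zero he) (fun e he ↦ hA.oscillates_snd hW he)
      (hV.transGen_uniqueCrossing ((hA.finite.image _).insert v) hS hpq.fst_lt hpq.right_mem.1)
  have hreg : HasRegion (transferredValues (boundedShifts A N) v) (fun w ↦ Relation.TransGen
      (Matched (shiftedDifferences (insert (v, w) A)) (regularPoints V) (regularPoints W)))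
      p q := by
    clear h
    induction href using Relation.TransGen.trans_induction_on with
    | single h =>
      exact (h.1.hasRegion_follows hA hv h.2).mono fun w hw ↦
        .single (h.1.insert hA hvV hv h.2 hN hw)
    | @trans p m q h1 h2 ih1 ih2 =>
      refine HasRegion.trans (fun w ↦ .trans) (Matched.snd_lt_of_transGen h1)
        (Matched.snd_lt_of_transGen h2) ?_ ih1 ih2
      -- Signs at the junction come from the last link of the first chain; they make the fibre over
      -- `m.2` nonempty.
      have hsign : ∀ e ∈ shiftedDifferences A, 0 < e.1 m.1 → 0 < e.2 m.2 := by
        cases h1 with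
        | single h => exact fun e he ↦ (h.1.sign_right e he).1
        | tail _ h => exact fun e he ↦ (h.1.sign_right e he).1
      exact transferredValues_nonempty (hA.finite.boundedShifts N) fun c hc c' hc' ↦
        lt_of_lt_of_mem_boundedShifts hsign hc hc'
  exact hreg.exists_isOpen

lemma norm_sub_lt_one_of_transGen_matched
    (h : Relation.TransGen (Matched (shiftedDifferences A) (regularPoints V) (regularPoints W))
      (0, 0) (1, 1)) {a b : C(unitInterval, ℝ) × C(unitInterval, ℝ)} (ha : a ∈ A) (hb : b ∈ A)
    (hab : ‖a.1 - b.1‖ < 1) : ‖a.2 - b.2‖ < 1 := by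
  by_cases hne : a = b
  · simp [hne]
  rw [ContinuousMap.norm_lt_iff _ one_pos] at hab ⊢
  intro y
  -- The shift `-1` expresses the two halves of |a - b| < 1 as positivity of a - b + 1 and b - a +
  -- 1.
  have h1 := Matched.forall_pos_of_transGen h ⟨a, ha, b, hb, hne, -1, rfl⟩ (fun x _ ↦ by
    have := (abs_lt.1 (hab x)).1
    simp at this ⊢
    linarith) y ⟨y.2.1, y.2.2⟩
  have h2 := Matched.forall_pos_of_transGen h ⟨b, hb, a, ha, Ne.symm hne, -1, rfl⟩ (fun x _ ↦ by
    have := (abs_lt.1 (hab x)).2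
    simp at this ⊢
    linarith) y ⟨y.2.1, y.2.2⟩
  simp at h1 h2
  rw [Real.norm_eq_abs, abs_lt]
  constructor <;> simp <;> linarith

end

/-! ### Pattern-preserving partial isomorphisms and the theorem -/

/-- The pairs of functions underlying a set of pairs of vertices. -/
def vertexPairs {V W : Set C(unitInterval, ℝ)} (A : Finset (V × W)) :
    Set (C(unitInterval, ℝ) × C(unitInterval, ℝ)) :=
  (fun x : V × W ↦ ((x.1 : C(unitInterval, ℝ)), (x.2 : C(unitInterval, ℝ)))) '' A

/-- A finite partial isomorphism between graphs on `V` and `W` which preserves the crossing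
pattern of the functions. -/
structure IsPatternIso {V W : Set C(unitInterval, ℝ)} (G : SimpleGraph V) (H : SimpleGraph W)
    (A : Finset (V × W)) : Prop where
  fst_eq_iff : ∀ x ∈ A, ∀ y ∈ A, (x.1 = y.1 ↔ x.2 = y.2)
  adj_iff : ∀ x ∈ A, ∀ y ∈ A, (G.Adj x.1 y.1 ↔ H.Adj x.2 y.2)
  chain : Relation.TransGen
    (Matched (shiftedDifferences (vertexPairs A)) (regularPoints V) (regularPoints W)) (0, 0) (1, 1)

namespace IsPatternIso

variable {V W : Set C(unitInterval, ℝ)} {G : SimpleGraph V} {H : SimpleGraph W}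
  {A : Finset (V × W)}

lemma empty (hV : IsICDense V) (hW : IsICDense W) : IsPatternIso G H ∅ where
  fst_eq_iff := by simp
  adj_iff := by simp
  chain := .single
    { fst_lt := zero_lt_one
      snd_lt := zero_lt_one
      left_mem := ⟨hV.zero_mem_regularPoints, hW.zero_mem_regularPoints⟩
      right_mem := ⟨hV.one_mem_regularPoints, hW.one_mem_regularPoints⟩
      sign_left := by simp [shiftedDifferences, vertexPairs]
      sign_right := by simp [shiftedDifferences, vertexPairs]
      exists_zero_iff := by simp [shiftedDifferences, vertexPairs]
      eq_or_eq_neg := by simp [shiftedDifferences, vertexPairs] }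

lemma swap [DecidableEq (W × V)] (h : IsPatternIso G H A) :
    IsPatternIso H G (A.image Prod.swap) where
  fst_eq_iff := by
    simp only [Finset.mem_image]
    rintro _ ⟨x, hx, rfl⟩ _ ⟨y, hy, rfl⟩
    exact (h.fst_eq_iff x hx y hy).symm
  adj_iff := by
    simp only [Finset.mem_image]
    rintro _ ⟨x, hx, rfl⟩ _ ⟨y, hy, rfl⟩
    exact (h.adj_iff x hx y hy).symm
  chain := by
    have : shiftedDifferences (vertexPairs (A.image Prod.swap)) =
        Prod.swap ⁻¹' shiftedDifferences (vertexPairs A) := by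
      have hsub {V W : Set C(unitInterval, ℝ)} [DecidableEq (W × V)] (A : Finset (V × W)) :
          shiftedDifferences (vertexPairs (A.image Prod.swap)) ⊆
            Prod.swap ⁻¹' shiftedDifferences (vertexPairs A) := by
        rintro _ ⟨_, ⟨a, ha, rfl⟩, _, ⟨b, hb, rfl⟩, hab, k, rfl⟩
        obtain ⟨a, ha', rfl⟩ := Finset.mem_image.1 ha
        obtain ⟨b, hb', rfl⟩ := Finset.mem_image.1 hb
        exact ⟨_, ⟨a, ha', rfl⟩, _, ⟨b, hb', rfl⟩, fun h ↦ hab (congrArg Prod.swap h), k, rfl⟩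
      classical
      refine (hsub A).antisymm fun e he ↦ ?_
      have := hsub (A.image Prod.swap) (a := e.swap) (by
        rw [Finset.image_image]
        simpa using he)
      simpa using this
    rw [this]
    exact Relation.TransGen.lift Prod.swap (fun _ _ h ↦ h.swap) _ _ h.chain

/-- Every vertex in the open set of admissible functions inherits the proximities of `v`. The images
of the neighbours of `v` are thus legitimate prescribed neighbours, and the e.c. property of `H`
gives `w`. -/
lemma exists_extend_fst (hV : IsICDense V) (hW : IsICDense W) (hG : IsGeometricEC G)
    (hH : IsGeometricEC H) (h : IsPatternIso G H A) (v : V) :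
    ∃ B, A ⊆ B ∧ IsPatternIso G H B ∧ ∃ w, (v, w) ∈ B := by
  classical
  by_cases hvA : ∃ w, (v, w) ∈ A
  · exact ⟨A, subset_rfl, h, hvA⟩
  have hv : ∀ x ∈ A, x.1 ≠ v := by
    rintro x hx rfl
    exact hvA ⟨x.2, hx⟩
  have hA : IsFinitePartialBij V W (vertexPairs A) :=
    { finite := A.finite_toSet.image _
      subset := by
        rintro _ ⟨x, -, rfl⟩
        exact ⟨x.1.2, x.2.2⟩
      fst_eq_iff := by
        rintro _ ⟨x, hx, rfl⟩ _ ⟨y, hy, rfl⟩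
        simpa [Subtype.ext_iff] using h.fst_eq_iff x hx y hy }
  obtain ⟨U, hU, hUne, hUw⟩ := exists_isOpen_forall_transGen_matched hV hW hA v.2 (by
    rintro _ ⟨x, hx, rfl⟩
    exact fun h ↦ hv x hx (Subtype.ext h)) h.chain
  obtain ⟨w, hwU, hwA, hadj⟩ := hH.exists_adj_iff U hU hUne (A.image Prod.snd)
    ((A.filter fun x ↦ G.Adj v x.1).image Prod.snd)
    (Finset.image_subset_image (Finset.filter_subset _ _)) (by
      intro w hw u hu
      obtain ⟨x, hx, rfl⟩ := Finset.mem_image.1 hu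
      obtain ⟨hxA, hvx⟩ := Finset.mem_filter.1 hx
      exact norm_sub_lt_one_of_transGen_matched (hUw w hw) (a := (↑v, ↑w)) (b := (↑x.1, ↑x.2))
        (Set.mem_insert _ _) (Set.mem_insert_of_mem _ ⟨x, hxA, rfl⟩) (hG.le_proximityGraph hvx).2)
  have hwx : ∀ x ∈ A, x.2 ≠ w := by
    rintro x hx rfl
    exact hwA (Finset.mem_image_of_mem _ hx)
  have hadj' : ∀ x ∈ A, (G.Adj v x.1 ↔ H.Adj w x.2) := by
    intro x hx
    rw [hadj x.2 (Finset.mem_image_of_mem _ hx)]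
    simp only [Finset.mem_image, Finset.mem_filter]
    constructor
    · exact fun hvx ↦ ⟨x, ⟨hx, hvx⟩, rfl⟩
    · rintro ⟨y, ⟨hy, hvy⟩, hyx⟩
      rwa [← (h.fst_eq_iff y hy x hx).2 hyx]
  refine ⟨insert (v, w) A, Finset.subset_insert _ _, ⟨?_, ?_, ?_⟩, w, Finset.mem_insert_self _ _⟩
  · simp only [Finset.mem_insert]
    rintro x (rfl | hx) y (rfl | hy)
    · simp
    · exact iff_of_false (hv y hy).symm (hwx y hy).symm
    · exact iff_of_false (hv x hx) (hwx x hx)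
    · exact h.fst_eq_iff x hx y hy
  · simp only [Finset.mem_insert]
    rintro x (rfl | hx) y (rfl | hy)
    · simp
    · exact hadj' y hy
    · rw [G.adj_comm, H.adj_comm]
      exact hadj' x hx
    · exact h.adj_iff x hx y hy
  · have hins : vertexPairs (insert (v, w) A) = insert (↑v, ↑w) (vertexPairs A) := by
      rw [vertexPairs, Finset.coe_insert, Set.image_insert_eq, vertexPairs]
    rw [hins]
    exact hUw w hwU

lemma exists_extend_snd (hV : IsICDense V) (hW : IsICDense W) (hG : IsGeometricEC G)
    (hH : IsGeometricEC H) (h : IsPatternIso G H A) (w : W) :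
    ∃ B, A ⊆ B ∧ IsPatternIso G H B ∧ ∃ v, (v, w) ∈ B := by
  classical
  obtain ⟨B, hAB, hB, v, hv⟩ := h.swap.exists_extend_fst hW hV hH hG w
  refine ⟨B.image Prod.swap, fun x hx ↦ ?_, hB.swap, v, Finset.mem_image_of_mem Prod.swap hv⟩
  exact Finset.mem_image.2 ⟨x.swap, hAB (Finset.mem_image_of_mem _ hx), x.swap_swap⟩

end IsPatternIso

/-- Geometrically e.c. graphs on IC-dense sets are isomorphic. -/
theorem IsGeometricEC.nonempty_iso {V W : Set C(unitInterval, ℝ)} (hV : IsICDense V)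
    (hW : IsICDense W) {G : SimpleGraph V} {H : SimpleGraph W} (hG : IsGeometricEC G)
    (hH : IsGeometricEC H) : Nonempty (G ≃g H) := by
  classical
  have : Countable V := hV.countable
  have : Countable W := hW.countable
  obtain ⟨e, he⟩ := exists_equiv_of_backAndForth (IsPatternIso G H) (fun _ h ↦ h.fst_eq_iff)
    (.empty hV hW) (fun _ h ↦ h.exists_extend_fst hV hW hG hH)
    (fun _ h ↦ h.exists_extend_snd hV hW hG hH)
  refine ⟨⟨e, fun {a b} ↦ ?_⟩⟩
  obtain ⟨A, hA, ha, hb⟩ := he a b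
  exact (hA.adj_iff _ ha _ hb).symm

theorem mainTheorem2 :
    ∃ GR : SimpleGraph ℕ, ∀ V : Set C(unitInterval, ℝ), IsICDense V →
      ∀ p : unitInterval, 0 < p → p < 1 → ∀ᵐ G ∂(LARG V p), Nonempty (G ≃g GR) := by
  by_cases hex : ∃ V : Set C(unitInterval, ℝ), IsICDense V
  swap
  -- Without IC-dense sets the claim is vacuous and any graph will do.
  · exact ⟨⊥, fun V hV ↦ absurd ⟨V, hV⟩ hex⟩
  obtain ⟨W, hW⟩ := hex
  have : Countable W := hW.countable
  have : Infinite W := by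
    have := hW.dense.infinite_inter_isOpen isOpen_univ Set.univ_nonempty
    rw [Set.inter_univ] at this
    exact this.to_subtype
  -- One geometrically e.c. sample on one IC-dense set serves as the model; the choice of `p₀` is
  -- immaterial.
  obtain ⟨p₀, hp₀, hp₁⟩ := exists_between (zero_lt_one (α := unitInterval))
  obtain ⟨H, hH⟩ := (ae_LARG_isGeometricEC hW.dense hW.countable hp₀ hp₁).exists
  obtain ⟨e⟩ := nonempty_equiv_of_countable (α := ℕ) (β := W)
  refine ⟨H.comap e, fun V hV p hp0 hp1 ↦ ?_⟩
  filter_upwards [ae_LARG_isGeometricEC hV.dense hV.countable hp0 hp1] with G hG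
  obtain ⟨φ⟩ := hG.nonempty_iso hV hW hH
  exact ⟨φ.trans (SimpleGraph.Iso.comap e H).symm⟩
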